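/- **Theorem 3.1.** Let $\mathbb T=\mathbb R/2\pi\mathbb Z$, let $\mathbb H$ be the Hilbert transform in $x\in\mathbb T$ (the Fourier multiplier with symbol $-i\,\mathrm{sgn}\,k$, $\mathrm{sgn}\,0=0$), write $[h;\mathbb H]f=h\,\mathbb H[f]-\mathbb H[hf]$, and for $\gamma\ge 1$ put $$\|f\|_{L^2_\gamma(\mathbb R\times\mathbb T)}^2=\int_{\mathbb R}\int_{\mathbb T}e^{-2\gamma t}|f(t,x)|^2\,dx\,dt .$$ For $\mu\in\mathbb R$ and real functions $\varphi_0,\varphi'$ on $\mathbb R\times\mathbb T$, with $\phi_0=\mathbb H[\varphi_0]$ and $\phi'=\mathbb H[\varphi']$, let $$\mathbb L'[\varphi_0]\varphi'=\varphi'_{tt}-\mu\varphi'_{xx}-\Big(2\,\mathbb H[\phi_{0,x}\phi'_x]-[\phi';\mathbb H]\phi_{0,xx}-[\phi_0;\mathbb H]\phi'_{xx}\Big)_x ,$$ the linearization about $\varphi_0$ of the operator $\mathbb L[\varphi]=\varphi_{tt}-\mu\varphi_{xx}-\big(\mathbb H[\phi_x^2]-[\phi;\mathbb H]\phi_{xx}\big)_x$,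 $\phi=\mathbb H[\varphi]$. Let $\delta>0$ and $\mu\in\mathbb R$. Let the basic state $\varphi_0:\mathbb R\times\mathbb T\to\mathbb R$, with zero spatial mean, satisfy $$\varphi_0\in L^\infty(\mathbb R;H^3(\mathbb T)),\qquad \varphi_{0,t}\in L^\infty(\mathbb R;H^2(\mathbb T)),\qquad \mu-2\phi_{0,x}\ge \delta/2\ \text{ in }\mathbb R\times\mathbb T .$$ Then there exist a constant $\gamma_0\ge 1$, depending only on $\delta$ and on upper bounds for the norms $\|\varphi_0\|_{L^\infty(\mathbb R;H^3(\mathbb T))}$ and $\|\varphi_{0,t}\|_{L^\infty(\mathbb R;H^2(\mathbb T))}$, and a constant $C_0>0$, depending only on $\delta$, such that for all $\gamma\ge\gamma_0$ and every function $\varphi':\mathbb R\times\mathbb T\to\mathbb R$ of class $C^2$ with zero spatial mean and with $\varphi'_t,\varphi'_x\in L^2_\gamma(\mathbb R\times\mathbb T)$, $$\gamma\Big\{\|\varphi'_t\|^2_{L^2_\gamma(\mathbb R\times\mathbb T)}+\|\varphi'_x\|^2_{L^2_\gamma(\mathbb R\times\mathbb T)}\Big\}\le\frac{C_0}{\gamma}\,\big\|\mathbb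 L'[\varphi_0]\varphi'\big\|^2_{L^2_\gamma(\mathbb R\times\mathbb T)} ,$$ where the right-hand side is $+\infty$ if $\mathbb L'[\varphi_0]\varphi'\notin L^2_\gamma(\mathbb R\times\mathbb T)$. -/

import Mathlib

open MeasureTheory
open scoped ENNReal NNReal ContDiff

namespace CurrentVortex

noncomputable section

/-- The torus `ℝ / 2πℤ`; its measure `volume` is `dx`, of total mass `2π`. -/
abbrev Torus : Type := AddCircle (2 * Real.pi)

instance factTwoPiPos : Fact (0 < 2 * Real.pi) := ⟨Real.two_pi_pos⟩

/-- The Fourier multiplier with symbol `A`, that is `f ↦ ∑ₖ A(k) cₖ(f) e^{ikx}`, the series being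
summed in `L²`. Here `cₖ(f) = fourierCoeff f k = (2π)⁻¹ ∫ f(x) e^{-ikx} dx`, and
`fourierLp 2 k` is the function `e^{ikx}`. The value is meaningful when the sequence `A(k) cₖ(f)`
is square summable. -/
def multiplier (A : ℤ → ℂ) (f : Torus → ℂ) : Torus → ℂ :=
  ⇑(∑' k : ℤ, (A k * fourierCoeff f k) •
    (fourierLp 2 k : Lp ℂ 2 (AddCircle.haarAddCircle (T := 2 * Real.pi))))

/-- The (discrete) Hilbert transform, with symbol `-i sgn k` and `sgn 0 = 0`. -/
def hilbert (f : Torus → ℂ) : Torus → ℂ :=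
  multiplier (fun k => -Complex.I * (Int.sign k : ℂ)) f

/-- The (weak) derivative `∂ₓ` of a function in `H¹(𝕋)`, with symbol `ik`. -/
def Dx (f : Torus → ℂ) : Torus → ℂ :=
  multiplier (fun k => Complex.I * (k : ℂ)) f

/-- The commutator `[h ; ℍ] f = h ℍ[f] - ℍ[h f]`. -/
def commHilbert (h f : Torus → ℂ) : Torus → ℂ :=
  h * hilbert f - hilbert (h * f)

/-- A real function of the space variable, seen as a complex one. -/
def toC (f : Torus → ℝ) : Torus → ℂ := fun x => (f x : ℂ)

/-- The norm of `Hᵐ(𝕋)`: `‖f‖² = (2π)⁻¹ ∑ₖ (1 + |k|)²ᵐ |∫ f(x) e^{-ikx} dx|²`, which equals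
`2π ∑ₖ (1 + |k|)²ᵐ |cₖ(f)|²`. It is infinite when `f ∈ L²(𝕋)` is not in `Hᵐ(𝕋)`. -/
def sobolevNorm (m : ℕ) (f : Torus → ℂ) : ℝ≥0∞ :=
  (ENNReal.ofReal (2 * Real.pi) *
    ∑' k : ℤ, ENNReal.ofReal ((1 + |(k : ℝ)|) ^ (2 * m) * ‖fourierCoeff f k‖ ^ 2)) ^ (1 / 2 : ℝ)

/-- The norm of `L^∞(ℝ; Hᵐ(𝕋))`. -/
def linftySobolevNorm (m : ℕ) (f : ℝ → Torus → ℝ) : ℝ≥0∞ :=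
  essSup (fun t => sobolevNorm m (toC (f t))) volume

/-- Membership in `L^∞(ℝ; Hᵐ(𝕋))` of a real function of `(t, x)`. -/
def MemLinftySobolev (m : ℕ) (f : ℝ → Torus → ℝ) : Prop :=
  AEStronglyMeasurable (fun p : ℝ × Torus => f p.1 p.2) (volume.prod volume) ∧
  (∀ᵐ t : ℝ, MemLp (f t) 2 volume) ∧
  linftySobolevNorm m f < ⊤

/-- `g` is the weak derivative `∂ₜ f`: the identity `∫ η' f dt = - ∫ η g dt` between functions
of `x` (up to null sets) holds for all test functions `η ∈ C_c^∞(ℝ)`. -/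
def IsWeakTimeDeriv (f g : ℝ → Torus → ℝ) : Prop :=
  ∀ η : ℝ → ℝ, ContDiff ℝ ∞ η → HasCompactSupport η →
    ∀ᵐ x : Torus, ∫ t : ℝ, deriv η t * f t x = - ∫ t : ℝ, η t * g t x

/-- The squared norm of `L²_γ(ℝ × 𝕋)`: `∫ ‖e^{-γt} f(t)‖²_{L²(𝕋)} dt`. -/
def weightedNormSq {E : Type*} [NormedAddCommGroup E] [NormedSpace ℝ E]
    (γ : ℝ) (f : ℝ → Torus → E) : ℝ≥0∞ :=
  ∫⁻ t : ℝ, ∫⁻ x : Torus, ‖Real.exp (-(γ * t)) • f t x‖ₑ ^ 2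

/-- The classical partial derivative in time. -/
def partialT (f : ℝ → Torus → ℝ) : ℝ → Torus → ℝ :=
  fun t x => deriv (fun τ : ℝ => f τ x) t

/-- The classical partial derivative in space. -/
def partialX (f : ℝ → Torus → ℝ) : ℝ → Torus → ℝ :=
  fun t x => deriv (fun y : ℝ => f t (x + (y : Torus))) 0

/-- Functions of class `C²` on `ℝ × 𝕋`. -/
def IsC2 (f : ℝ → Torus → ℝ) : Prop :=
  ContDiff ℝ 2 (fun p : ℝ × ℝ => f p.1 (p.2 : Torus))

/-- The part under `∂ₓ` of the linearized operator, at a fixed time: with `p₀ = ℍ[u₀]` and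
`p = ℍ[u]`, it is `2 ℍ[p₀ₓ pₓ] - [p ; ℍ] p₀ₓₓ - [p₀ ; ℍ] pₓₓ`. -/
def linearizedFlux (u₀ u : Torus → ℂ) : Torus → ℂ :=
  (2 : ℂ) • hilbert (Dx (hilbert u₀) * Dx (hilbert u))
    - commHilbert (hilbert u) (Dx (Dx (hilbert u₀)))
    - commHilbert (hilbert u₀) (Dx (Dx (hilbert u)))

/-- The linearized operator
`L'[φ₀]φ' = φ'ₜₜ - μ φ'ₓₓ - (2 ℍ[p₀ₓ p'ₓ] - [p' ; ℍ] p₀ₓₓ - [p₀ ; ℍ] p'ₓₓ)ₓ`,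
where `p₀ = ℍ[φ₀]` and `p' = ℍ[φ']`. (It takes real values almost everywhere.) -/
def linearizedOp (μ : ℝ) (φ₀ φ' : ℝ → Torus → ℝ) : ℝ → Torus → ℂ :=
  fun t x =>
    (partialT (partialT φ') t x : ℂ) - (μ : ℂ) * (partialX (partialX φ') t x : ℂ)
      - Dx (linearizedFlux (toC (φ₀ t)) (toC (φ' t))) x

end

end CurrentVortex

open CurrentVortex

/-!
Since `ℍ² = -1` on functions of zero mean, the linearized flux is `-2 p₀ₓ φ'ₓ` plus commutators of
`ℍ` with functions of `x`, so that the linearized equation reads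
`φ'ₜₜ - ((μ - 2 p₀ₓ) φ'ₓ)ₓ + R = f`. The symbol `sgn l - sgn k` of a commutator vanishes unless
`|k|, |l| ≤ |k - l|`, so every derivative can be moved onto the basic state: the `k`-th coefficient
of `R` is at most `8 ∑ₗ |k - l|² |c_{k-l}(φ₀)| |l| |c_l(φ')|`, and Young's inequality `ℓ¹ * ℓ² ⊆ ℓ²`
gives `‖R‖ ≤ C ‖φ'ₓ‖` in `L²(𝕋)`, where `C` depends on `‖φ₀‖_{H³}` only
(`abs_symbol_le`, `linearizedFlux_structure`). This is an operator of order zero in the energy, and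
the equation is a wave equation which is strictly hyperbolic because `μ - 2 p₀ₓ ≥ δ / 2`.

The energy `E(t) = ∫ φ'ₜ² + (μ - 2 p₀ₓ) φ'ₓ² dx` then satisfies
`E' = 2 ∫ φ'ₜ (f - R) - 2 ∫ p₀ₓₜ φ'ₓ²`. As `φ₀` is only weakly differentiable in time, this holds
against test functions `θ(t)` (`integral_mul_energyRate`). The term with `p₀ₓ = |D| φ₀` is written
with Fourier coefficients (`absPairing`), so that only the scalar functions `t ↦ c_k(φ₀(t))` have to
be differentiated (`weak_deriv_contDiff_one_complex`, `integral_absPairing_deriv`), and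
`|∫ (|D| φ₀ₜ) w| ≤ (∑ₖ |k| |c_k(φ₀ₜ)|) ∫ |w|` is finite because `φ₀ₜ ∈ H²`. Taking
`θ = e^{-2γt} χ(t / n)` and letting `n → ∞` produces `γ ∫ e^{-2γt} E dt` on the left-hand side, which
for large `γ` absorbs all the terms except the source (`weighted_energy_estimate`).

The norm in time of the source is the integral of a function of `t` whose measurability is not
obvious; the estimate uses it only as an upper bound of a measurable function (`energyRate_le`).
-/

namespace CurrentVortex

/-! ### Fourier coefficients of square integrable functions -/

/-- The normalized Haar measure `dx / 2π` of the torus. -/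
noncomputable abbrev haar : Measure Torus := AddCircle.haarAddCircle

/-- `f ∈ L²(𝕋)` has Fourier coefficients `c`. -/
structure HasCoeff (f : Torus → ℂ) (c : ℤ → ℂ) : Prop where
  memLp : MemLp f 2 haar
  coeff : ∀ k, fourierCoeff f k = c k

namespace HasCoeff

variable {f g : Torus → ℂ} {c d : ℤ → ℂ}

lemma of_memLp (hf : MemLp f 2 haar) : HasCoeff f (fourierCoeff f) := ⟨hf, fun _ => rfl⟩

lemma congr (h : HasCoeff f c) (hcd : ∀ k, c k = d k) : HasCoeff f d :=
  ⟨h.memLp, fun k => (h.coeff k).trans (hcd k)⟩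

lemma coeff_toLp (h : HasCoeff f c) (k : ℤ) : fourierCoeff (h.memLp.toLp f) k = c k := by
  rw [fourierCoeff_congr_ae h.memLp.coeFn_toLp, h.coeff]

lemma repr_toLp (h : HasCoeff f c) (k : ℤ) : fourierBasis.repr (h.memLp.toLp f) k = c k := by
  rw [fourierBasis_repr, h.coeff_toLp]

lemma integrable (hf : HasCoeff f c) : Integrable f haar := hf.memLp.integrable (by norm_num)

lemma add (hf : HasCoeff f c) (hg : HasCoeff g d) : HasCoeff (f + g) (fun k => c k + d k) :=
  ⟨hf.memLp.add hg.memLp, fun k => by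
    rw [fourierCoeff.add hf.integrable hg.integrable, Pi.add_apply, hf.coeff, hg.coeff]⟩

lemma const_smul (hf : HasCoeff f c) (a : ℂ) : HasCoeff (a • f) (fun k => a * c k) :=
  ⟨hf.memLp.const_smul a, fun k => by rw [fourierCoeff.const_smul, hf.coeff, smul_eq_mul]⟩

lemma sub (hf : HasCoeff f c) (hg : HasCoeff g d) : HasCoeff (f - g) (fun k => c k - d k) := by
  have := hf.add (hg.const_smul (-1))
  simp only [neg_smul, one_smul, neg_mul, one_mul, ← sub_eq_add_neg] at this
  exact this

lemma hasSum_sq (hf : HasCoeff f c) :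
    HasSum (fun k => ‖c k‖ ^ 2) (∫ x, ‖f x‖ ^ 2 ∂haar) := by
  have := hasSum_sq_fourierCoeff (hf.memLp.toLp f)
  simp_rw [hf.coeff_toLp] at this
  convert this using 1
  apply integral_congr_ae
  filter_upwards [hf.memLp.coeFn_toLp] with x hx
  rw [hx]

/-- Parseval's identity, in its bilinear form. -/
lemma hasSum_mul (hf : HasCoeff f c) (hg : HasCoeff g d) :
    HasSum (fun k => c (-k) * d k) (∫ x, f x * g x ∂haar) := by
  -- the inner product of `conj f` and `g` is bilinear in `(f, g)`
  have hF : MemLp (star f) 2 haar := hf.memLp.star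
  have h := fourierBasis.hasSum_inner_mul_inner (hF.toLp _) (hg.memLp.toLp g)
  have h1 : inner ℂ (hF.toLp _) (hg.memLp.toLp g) = ∫ x, f x * g x ∂haar := by
    rw [MeasureTheory.L2.inner_def]
    apply integral_congr_ae
    filter_upwards [hF.coeFn_toLp, hg.memLp.coeFn_toLp] with x hx hy
    rw [hx, hy]
    simp [mul_comm]
  rw [h1] at h
  refine h.congr_fun fun k => ?_
  rw [← fourierBasis.repr_apply_apply, hg.repr_toLp]
  congr 1
  rw [← inner_conj_symm, ← fourierBasis.repr_apply_apply, fourierBasis_repr,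
    fourierCoeff_congr_ae hF.coeFn_toLp, ← hf.coeff, fourierCoeff, fourierCoeff, ← integral_conj]
  congr 1
  ext x
  simp [fourier_neg, -fourier_apply, Pi.star_apply]

/-- Multiplication by `e^{inx}` shifts the coefficients. -/
lemma fourier_mul (hf : HasCoeff f c) (n : ℤ) :
    HasCoeff (fun x => fourier n x * f x) (fun k => c (k - n)) := by
  refine ⟨?_, fun k => ?_⟩
  · refine MemLp.of_le hf.memLp ?_ ?_
    · exact ((map_continuous (fourier n)).aestronglyMeasurable).mul hf.memLp.1
    · refine ae_of_all _ fun x => ?_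
      rw [norm_mul, fourier_apply, Circle.norm_coe, one_mul]
  · rw [← hf.coeff, fourierCoeff, fourierCoeff]
    congr 1
    ext x
    rw [smul_eq_mul, ← mul_assoc, ← fourier_add, smul_eq_mul]
    congr 3
    ring

/-- The coefficients of a product are a convolution. -/
lemma hasSum_coeff_mul (hf : HasCoeff f c) (hg : HasCoeff g d) (k : ℤ) :
    HasSum (fun l => c (k - l) * d l) (fourierCoeff (f * g) k) := by
  have h := (hf.fourier_mul (-k)).hasSum_mul hg
  convert h using 1
  · ext l
    congr 2
    ring
  · rw [fourierCoeff]
    congr 1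
    ext x
    simp [mul_assoc]

/-- A function with summable Fourier coefficients is essentially bounded. -/
lemma ae_norm_le (hf : HasCoeff f c) (hc : Summable fun k => ‖c k‖) :
    ∀ᵐ x ∂haar, ‖f x‖ ≤ ∑' k, ‖c k‖ := by
  have hs : Summable fun k => c k • (fourier k : C(Torus, ℂ)) := by
    refine Summable.of_norm ?_
    simpa [norm_smul, fourier_norm] using hc
  have h1 := (ContinuousMap.toLp (E := ℂ) 2 haar ℂ).hasSum hs.hasSum
  have h2 := hasSum_fourier_series_L2 (hf.memLp.toLp f)
  simp_rw [hf.coeff_toLp] at h2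
  have h3 : ContinuousMap.toLp (E := ℂ) 2 haar ℂ (∑' k, c k • (fourier k : C(Torus, ℂ)))
      = hf.memLp.toLp f := by
    refine h1.unique ?_
    convert h2 using 2
    simp [fourierLp]
  filter_upwards [hf.memLp.coeFn_toLp, ContinuousMap.coeFn_toLp (p := 2) haar (𝕜 := ℂ)
    (∑' k, c k • (fourier k : C(Torus, ℂ)))] with x hx hy
  rw [h3, hx] at hy
  rw [hy]
  refine (ContinuousMap.norm_coe_le_norm _ x).trans ?_
  refine (norm_tsum_le_tsum_norm ?_).trans_eq ?_
  · simpa [norm_smul, fourier_norm] using hc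
  · simp [norm_smul, fourier_norm]

/-- The product of a function with summable Fourier coefficients and of an `L²` function. -/
lemma mul (hf : HasCoeff f c) (hc : Summable fun k => ‖c k‖) (hg : HasCoeff g d) :
    HasCoeff (f * g) (fun k => ∑' l, c (k - l) * d l) := by
  refine ⟨?_, fun k => (hf.hasSum_coeff_mul hg k).tsum_eq.symm⟩
  have : MemLp f ⊤ haar := memLp_top_of_bound hf.memLp.1 _ (hf.ae_norm_le hc)
  exact hg.memLp.mul this

/-- A multiplier which keeps the coefficients square summable. -/
lemma multiplier (hf : HasCoeff f c) (A : ℤ → ℂ) (h : Summable fun k => ‖A k * c k‖ ^ 2) :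
    HasCoeff (multiplier A f) (fun k => A k * c k) := by
  have hm : Memℓp (fun k => A k * c k) 2 := by
    rw [memℓp_gen_iff (by norm_num)]
    simpa using h
  have h1 := (fourierBasis (T := 2 * Real.pi)).hasSum_repr_symm ⟨_, hm⟩
  have h2 : (∑' k : ℤ, (A k * fourierCoeff f k) •
      (fourierLp 2 k : Lp ℂ 2 (AddCircle.haarAddCircle (T := 2 * Real.pi))))
      = fourierBasis.repr.symm ⟨_, hm⟩ := by
    rw [← h1.tsum_eq]
    simp [hf.coeff]
  rw [CurrentVortex.multiplier, h2]
  refine ⟨Lp.memLp _, fun k => ?_⟩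
  rw [← fourierBasis_repr]
  simp

end HasCoeff

/-! ### Convolution of sequences -/

lemma ennreal_two_mul_le_sq_add_sq (a b : ℝ≥0∞) : 2 * (a * b) ≤ a ^ 2 + b ^ 2 := by
  rcases eq_or_ne a ⊤ with rfl | ha
  · simp
  rcases eq_or_ne b ⊤ with rfl | hb
  · simp
  lift a to ℝ≥0 using ha
  lift b to ℝ≥0 using hb
  have : 2 * (a * b) ≤ a ^ 2 + b ^ 2 := by
    rw [← NNReal.coe_le_coe]
    push_cast
    nlinarith [sq_nonneg ((a : ℝ) - b)]
  exact_mod_cast this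

/-- The Cauchy-Schwarz inequality for the measure on `ℤ` with weights `A`. -/
lemma sq_tsum_mul_le (A B : ℤ → ℝ≥0∞) :
    (∑' l, A l * B l) ^ 2 ≤ (∑' l, A l) * ∑' l, A l * B l ^ 2 := by
  have h : 2 * (∑' l, A l * B l) ^ 2 ≤ 2 * ((∑' l, A l) * ∑' l, A l * B l ^ 2) := by
    -- expand the square and use `2 Bₗ Bₘ ≤ Bₗ² + Bₘ²`
    calc 2 * (∑' l, A l * B l) ^ 2
        = ∑' l, ∑' m, 2 * ((A l * B l) * (A m * B m)) := by
          simp_rw [ENNReal.tsum_mul_left, ENNReal.tsum_mul_right, sq]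
      _ ≤ ∑' l, ∑' m, ((A l * B l ^ 2) * A m + A l * (A m * B m ^ 2)) := by
          refine ENNReal.tsum_le_tsum fun l => ENNReal.tsum_le_tsum fun m => ?_
          calc 2 * ((A l * B l) * (A m * B m)) = A l * A m * (2 * (B l * B m)) := by ring
            _ ≤ A l * A m * (B l ^ 2 + B m ^ 2) := by
              gcongr; exact ennreal_two_mul_le_sq_add_sq _ _
            _ = _ := by ring
      _ = 2 * ((∑' l, A l) * ∑' l, A l * B l ^ 2) := by
          simp_rw [ENNReal.tsum_add, ENNReal.tsum_mul_left, ENNReal.tsum_mul_right]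
          ring
  rwa [ENNReal.mul_le_mul_iff_right (by norm_num) (by norm_num)] at h

/-- Young's inequality `ℓ¹ * ℓ² ⊆ ℓ²`. -/
lemma tsum_convolution_sq_le (A B : ℤ → ℝ≥0∞) :
    ∑' k, (∑' l, A (k - l) * B l) ^ 2 ≤ (∑' k, A k) ^ 2 * ∑' l, B l ^ 2 := by
  calc ∑' k, (∑' l, A (k - l) * B l) ^ 2
      ≤ ∑' k, (∑' l, A l) * ∑' l, A (k - l) * B l ^ 2 := by
        refine ENNReal.tsum_le_tsum fun k => ?_
        refine (sq_tsum_mul_le (fun l => A (k - l)) B).trans_eq ?_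
        congr 1
        exact (Equiv.subLeft k).tsum_eq A
    _ = (∑' l, A l) * ∑' l, ∑' k, A (k - l) * B l ^ 2 := by
        rw [ENNReal.tsum_mul_left, ENNReal.tsum_comm]
    _ = (∑' l, A l) * ∑' l, (∑' k, A k) * B l ^ 2 := by
        congr 2
        ext l
        rw [ENNReal.tsum_mul_right]
        congr 1
        exact (Equiv.subRight l).tsum_eq A
    _ = _ := by rw [ENNReal.tsum_mul_left]; ring

/-- Young's inequality for a double sequence dominated by the terms of a convolution. -/
lemma summable_sq_of_le_convolution {A B : ℤ → ℝ} (hA0 : ∀ k, 0 ≤ A k) (hA : Summable A)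
    (hB0 : ∀ k, 0 ≤ B k) (hB : Summable fun k => B k ^ 2) {T : ℤ → ℤ → ℂ} {F : ℤ → ℂ}
    (hF : ∀ k, HasSum (T k) (F k)) (hT : ∀ k l, ‖T k l‖ ≤ A (k - l) * B l) :
    Summable (fun k => ‖F k‖ ^ 2) ∧ ∑' k, ‖F k‖ ^ 2 ≤ (∑' k, A k) ^ 2 * ∑' k, B k ^ 2 := by
  have key : ∑' k, ENNReal.ofReal (‖F k‖ ^ 2)
      ≤ ENNReal.ofReal ((∑' k, A k) ^ 2 * ∑' k, B k ^ 2) := by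
    rw [ENNReal.ofReal_mul (by positivity), ENNReal.ofReal_pow (tsum_nonneg hA0),
      ENNReal.ofReal_tsum_of_nonneg hA0 hA,
      ENNReal.ofReal_tsum_of_nonneg (fun k => sq_nonneg _) hB]
    simp_rw [fun k => ENNReal.ofReal_pow (hB0 k) 2]
    refine le_trans (ENNReal.tsum_le_tsum fun k => ?_)
      (tsum_convolution_sq_le (fun k => ENNReal.ofReal (A k))
        (fun k => ENNReal.ofReal (B k)))
    rw [ENNReal.ofReal_pow (norm_nonneg _), ofReal_norm, ← (hF k).tsum_eq]
    gcongr
    refine enorm_tsum_le_tsum_enorm.trans (ENNReal.tsum_le_tsum fun l => ?_)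
    rw [← ENNReal.ofReal_mul (hA0 _), ← ofReal_norm]
    exact ENNReal.ofReal_le_ofReal (hT k l)
  have hs : Summable (fun k => ‖F k‖ ^ 2) := by
    have := ENNReal.summable_toReal (ne_top_of_le_ne_top ENNReal.ofReal_ne_top key)
    simpa [ENNReal.toReal_ofReal] using this
  refine ⟨hs, ?_⟩
  rw [← ENNReal.ofReal_tsum_of_nonneg (fun k => sq_nonneg _) hs] at key
  refine (ENNReal.ofReal_le_ofReal_iff ?_).1 key
  have : 0 ≤ ∑' k, B k ^ 2 := tsum_nonneg fun k => sq_nonneg (B k)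
  positivity

/-! ### The linearized flux at a fixed time -/

/-- The symbol estimate for the remainder of order zero in the linearized flux: the factors
`sgn l - sgn k` vanish unless both `|k|` and `|l|` are at most `|k - l|`. -/
lemma abs_symbol_le (j l : ℤ) :
    |(j + l) * (2 * j * j.sign * l * (1 - (j + l).sign * l.sign)
      + j ^ 2 * j.sign * (j.sign - (j + l).sign) * l.sign
      + j.sign * l ^ 2 * l.sign * (l.sign - (j + l).sign))| ≤ 8 * (j ^ 2 * |l|) := by
  have pos : ∀ m : ℤ, 0 < m → m.sign = 1 := fun m => Int.sign_eq_one_of_pos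
  have neg : ∀ m : ℤ, m < 0 → m.sign = -1 := fun m => Int.sign_eq_neg_one_of_neg
  rcases lt_trichotomy j 0 with hj | rfl | hj
  · rcases lt_trichotomy l 0 with hl | rfl | hl
    · rw [neg j hj, neg l hl, neg (j + l) (by omega)]
      norm_num
      positivity
    · simp
    · rcases lt_trichotomy (j + l) 0 with hk | hk | hk
      · rw [neg j hj, pos l hl, neg (j + l) hk, abs_of_pos hl, abs_le]
        constructor <;> nlinarith [mul_pos hl (neg_pos.2 hj), mul_pos hl (neg_pos.2 hk),
          mul_pos (mul_pos hl (neg_pos.2 hj)) (neg_pos.2 hk),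
          mul_pos (mul_pos hl hl) (neg_pos.2 hk), mul_pos (mul_pos hl hl) (neg_pos.2 hj),
          mul_pos (mul_pos hl (neg_pos.2 hj)) (neg_pos.2 hj)]
      · rw [hk]
        simp
        positivity
      · rw [neg j hj, pos l hl, pos (j + l) hk, abs_of_pos hl, abs_le]
        constructor <;> nlinarith [mul_pos hl (neg_pos.2 hj),
          mul_pos (mul_pos (neg_pos.2 hj) (neg_pos.2 hj)) hk,
          mul_pos (mul_pos (neg_pos.2 hj) (neg_pos.2 hj)) (neg_pos.2 hj),
          mul_pos (mul_pos hl (neg_pos.2 hj)) (neg_pos.2 hj)]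
  · simp
  · rcases lt_trichotomy l 0 with hl | rfl | hl
    · rcases lt_trichotomy (j + l) 0 with hk | hk | hk
      · rw [pos j hj, neg l hl, neg (j + l) hk, abs_of_neg hl, abs_le]
        constructor <;> nlinarith [mul_pos (neg_pos.2 hl) hj,
          mul_pos (mul_pos hj hj) (neg_pos.2 hk), mul_pos (mul_pos hj hj) hj,
          mul_pos (mul_pos (neg_pos.2 hl) hj) hj]
      · rw [hk]
        simp
        positivity
      · rw [pos j hj, neg l hl, pos (j + l) hk, abs_of_neg hl, abs_le]
        constructor <;> nlinarith [mul_pos (neg_pos.2 hl) hj, mul_pos (neg_pos.2 hl) hk,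
          mul_pos (mul_pos (neg_pos.2 hl) hj) hk,
          mul_pos (mul_pos (neg_pos.2 hl) (neg_pos.2 hl)) hk,
          mul_pos (mul_pos (neg_pos.2 hl) (neg_pos.2 hl)) hj,
          mul_pos (mul_pos (neg_pos.2 hl) hj) hj]
    · simp
    · rw [pos j hj, pos l hl, pos (j + l) (by omega)]
      norm_num
      positivity

namespace HasCoeff

variable {f : Torus → ℂ} {c : ℤ → ℂ}

lemma hilbert (hf : HasCoeff f c) :
    HasCoeff (hilbert f) (fun k => -Complex.I * (Int.sign k : ℂ) * c k) := by
  refine hf.multiplier _ (hf.hasSum_sq.summable.of_nonneg_of_le (fun _ => sq_nonneg _) fun k => ?_)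
  rw [norm_mul, mul_pow]
  refine mul_le_of_le_one_left (sq_nonneg _) ?_
  rcases lt_trichotomy k 0 with h | rfl | h
  · simp [Int.sign_eq_neg_one_of_neg h]
  · simp
  · simp [Int.sign_eq_one_of_pos h]

lemma dx (hf : HasCoeff f c) (h : Summable fun k : ℤ => ‖Complex.I * (k : ℂ) * c k‖ ^ 2) :
    HasCoeff (Dx f) (fun k => Complex.I * (k : ℂ) * c k) :=
  hf.multiplier _ h

end HasCoeff

lemma norm_sign_le (k : ℤ) : ‖((Int.sign k : ℤ) : ℂ)‖ ≤ 1 := by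
  rcases lt_trichotomy k 0 with h | rfl | h
  · simp [Int.sign_eq_neg_one_of_neg h]
  · simp
  · simp [Int.sign_eq_one_of_pos h]

lemma abs_intCast_le_sq (k : ℤ) : |(k : ℝ)| ≤ (k : ℝ) ^ 2 := by
  have h := Int.natAbs_le_self_sq k
  have : ((k.natAbs : ℤ) : ℝ) ≤ ((k ^ 2 : ℤ) : ℝ) := by exact_mod_cast h
  simpa using this

lemma norm_sign_le_abs (k : ℤ) : ‖((Int.sign k : ℤ) : ℂ)‖ ≤ |(k : ℝ)| := by
  rcases eq_or_ne k 0 with rfl | h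
  · simp
  · refine (norm_sign_le k).trans ?_
    exact_mod_cast Int.one_le_abs h

/-- The Fourier structure of the linearized flux. Since `ℍ² = -1` on functions of zero mean,
`F = -2 p₀ₓ uₓ + (commutators)`, and the commutators gain two derivatives on the unknown at the
expense of the basic state. In the statement `w` are the coefficients of `p₀ₓ uₓ`, and `P` is its
derivative. -/
lemma linearizedFlux_structure {u₀ u ux : Torus → ℂ} {a b : ℤ → ℂ} (h₀ : HasCoeff u₀ a)
    (hu : HasCoeff u b) (hux : HasCoeff ux (fun k => Complex.I * (k : ℂ) * b k))
    (ha : Summable fun k : ℤ => (k : ℝ) ^ 2 * ‖a k‖)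
    (ha2 : Summable fun k : ℤ => ((k : ℝ) ^ 2 * ‖a k‖) ^ 2)
    (hb : Summable fun k : ℤ => ((k : ℝ) ^ 2 * ‖b k‖) ^ 2) :
    MemLp (Dx (linearizedFlux u₀ u)) 2 haar ∧
    ∃ w : ℤ → ℂ, HasCoeff (Dx (hilbert u₀) * ux) w ∧
    ∃ P : Torus → ℂ, HasCoeff P (fun k => Complex.I * (k : ℂ) * w k) ∧
      ∫ x, ‖Dx (linearizedFlux u₀ u) x + 2 * P x‖ ^ 2 ∂haar
        ≤ (8 * ∑' k : ℤ, (k : ℝ) ^ 2 * ‖a k‖) ^ 2 * ∫ x, ‖ux x‖ ^ 2 ∂haar := by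
  have hI6 : Complex.I ^ 6 = -1 := by
    rw [show 6 = 4 + 2 by norm_num, pow_add, Complex.I_pow_four, Complex.I_sq, one_mul]
  have le1 : ∀ k : ℤ, ‖Complex.I * (k : ℂ)‖ ≤ (k : ℝ) ^ 2 := fun k => by
    simpa using abs_intCast_le_sq k
  have les : ∀ k : ℤ, ‖-Complex.I * ((Int.sign k : ℤ) : ℂ)‖ ≤ 1 := fun k => by
    simpa using norm_sign_le k
  have les2 : ∀ k : ℤ, ‖-Complex.I * ((Int.sign k : ℤ) : ℂ)‖ ≤ (k : ℝ) ^ 2 := fun k => by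
    simpa using (norm_sign_le_abs k).trans (abs_intCast_le_sq k)
  have leq : ∀ k : ℤ, ‖Complex.I * (k : ℂ)‖ * ‖Complex.I * (k : ℂ)‖ = (k : ℝ) ^ 2 := fun k => by
    simp [← sq]
  have bd1 : ∀ (c : ℤ → ℂ) (k : ℤ), ‖Complex.I * (k : ℂ) * (-Complex.I * ((Int.sign k : ℤ) : ℂ) * c k)‖
      ≤ (k : ℝ) ^ 2 * ‖c k‖ := fun c k => by
    rw [norm_mul, norm_mul _ (c k), ← mul_assoc]
    gcongr
    exact (mul_le_of_le_one_right (norm_nonneg _) (les k)).trans (le1 k)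
  have bd2 : ∀ (c : ℤ → ℂ) (k : ℤ),
      ‖Complex.I * (k : ℂ) * (Complex.I * (k : ℂ) * (-Complex.I * ((Int.sign k : ℤ) : ℂ) * c k))‖
      ≤ (k : ℝ) ^ 2 * ‖c k‖ := fun c k => by
    rw [← mul_assoc, norm_mul _ (-Complex.I * _ * c k), norm_mul _ (c k), norm_mul, leq]
    exact mul_le_mul_of_nonneg_left (mul_le_of_le_one_left (norm_nonneg _) (les k)) (sq_nonneg _)
  have bd0 : ∀ (c : ℤ → ℂ) (k : ℤ), ‖-Complex.I * ((Int.sign k : ℤ) : ℂ) * c k‖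
      ≤ (k : ℝ) ^ 2 * ‖c k‖ := fun c k => by
    rw [norm_mul]
    exact mul_le_mul_of_nonneg_right (les2 k) (norm_nonneg _)
  have bd3 : ∀ (c : ℤ → ℂ) (k : ℤ), ‖-Complex.I * ((Int.sign k : ℤ) : ℂ) *
      (Complex.I * (k : ℂ) * (Complex.I * (k : ℂ) * (-Complex.I * ((Int.sign k : ℤ) : ℂ) * c k)))‖
      ≤ (k : ℝ) ^ 2 * ‖c k‖ := fun c k => by
    rw [norm_mul]
    exact (mul_le_of_le_one_left (norm_nonneg _) (les k)).trans (bd2 c k)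
  have sqs : ∀ {c d : ℤ → ℂ}, (Summable fun k : ℤ => ((k : ℝ) ^ 2 * ‖c k‖) ^ 2) →
      (∀ k, ‖d k‖ ≤ (k : ℝ) ^ 2 * ‖c k‖) → Summable fun k => ‖d k‖ ^ 2 := fun hc h =>
    hc.of_nonneg_of_le (fun _ => sq_nonneg _) fun k => by gcongr; exact h k
  -- the coefficients of the factors; those of `p₀` and of its derivatives are summable
  have hp₀ := h₀.hilbert
  have hp₀x := hp₀.dx (sqs ha2 (bd1 a))
  have hp₀xx := hp₀x.dx (sqs ha2 (bd2 a))
  have hHp₀xx := hp₀xx.hilbert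
  have hp := hu.hilbert
  have hpx := hp.dx (sqs hb (bd1 b))
  have hpxx := hpx.dx (sqs hb (bd2 b))
  have hHpxx := hpxx.hilbert
  have s_p₀ := ha.of_nonneg_of_le (fun _ => norm_nonneg _) (bd0 a)
  have s_p₀x := ha.of_nonneg_of_le (fun _ => norm_nonneg _) (bd1 a)
  have s_p₀xx := ha.of_nonneg_of_le (fun _ => norm_nonneg _) (bd2 a)
  have s_Hp₀xx := ha.of_nonneg_of_le (fun _ => norm_nonneg _) (bd3 a)
  -- the products
  have q1 := (hp₀x.mul s_p₀x hpx).hilbert.const_smul 2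
  have q2 := (hHp₀xx.mul s_Hp₀xx hp).sub (hp₀xx.mul s_p₀xx hp).hilbert
  have q3 := (hp₀.mul s_p₀ hHpxx).sub (hp₀.mul s_p₀ hpxx).hilbert
  have hF := (q1.sub q2).sub q3
  have eF : (2 : ℂ) • hilbert (Dx (hilbert u₀) * Dx (hilbert u))
      - (hilbert (Dx (Dx (hilbert u₀))) * hilbert u
        - hilbert (Dx (Dx (hilbert u₀)) * hilbert u))
      - (hilbert u₀ * hilbert (Dx (Dx (hilbert u)))
        - hilbert (hilbert u₀ * Dx (Dx (hilbert u))))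
      = linearizedFlux u₀ u := by
    rw [linearizedFlux, commHilbert, commHilbert,
      mul_comm (hilbert (Dx (Dx (hilbert u₀)))),
      mul_comm (Dx (Dx (hilbert u₀)))]
  rw [eF] at hF
  have hw := hp₀x.mul s_p₀x hux
  have t1 := fun k => hp₀x.hasSum_coeff_mul hpx k
  have t2 := fun k => hHp₀xx.hasSum_coeff_mul hp k
  have t2' := fun k => hp₀xx.hasSum_coeff_mul hp k
  have t3 := fun k => hp₀.hasSum_coeff_mul hHpxx k
  have t3' := fun k => hp₀.hasSum_coeff_mul hpxx k
  have tw := fun k => hp₀x.hasSum_coeff_mul hux k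
  -- `∂ₓ (F + 2 p₀ₓ uₓ)` is of order zero in `uₓ`
  have hR := summable_sq_of_le_convolution
    (A := fun k : ℤ => 8 * ((k : ℝ) ^ 2 * ‖a k‖)) (B := fun l : ℤ => ‖Complex.I * (l : ℂ) * b l‖)
    (fun k => by positivity) (ha.mul_left 8) (fun k => norm_nonneg _) hux.hasSum_sq.summable
    (fun k => ((((((t1 k).mul_left (-Complex.I * ((Int.sign k : ℤ) : ℂ))).mul_left 2).sub
      ((t2 k).sub ((t2' k).mul_left (-Complex.I * ((Int.sign k : ℤ) : ℂ))))).sub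
      ((t3 k).sub ((t3' k).mul_left (-Complex.I * ((Int.sign k : ℤ) : ℂ))))).add
      ((tw k).mul_left 2)).mul_left (Complex.I * (k : ℂ)))
    (fun k l => by
      obtain ⟨j, rfl⟩ : ∃ j, k = j + l := ⟨k - l, by ring⟩
      rw [add_sub_cancel_right]
      have hsym : ‖(((j + l) * (2 * j * j.sign * l * (1 - (j + l).sign * l.sign)
          + j ^ 2 * j.sign * (j.sign - (j + l).sign) * l.sign
          + j.sign * l ^ 2 * l.sign * (l.sign - (j + l).sign)) : ℤ) : ℂ)‖
          ≤ 8 * ((j : ℝ) ^ 2 * |(l : ℝ)|) := by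
        rw [Complex.norm_intCast]
        exact_mod_cast abs_symbol_le j l
      calc _ = ‖-(((j + l) * (2 * j * j.sign * l * (1 - (j + l).sign * l.sign)
          + j ^ 2 * j.sign * (j.sign - (j + l).sign) * l.sign
          + j.sign * l ^ 2 * l.sign * (l.sign - (j + l).sign)) : ℤ) : ℂ) * (a j * b l)‖ := by
            congr 1
            push_cast
            ring_nf
            simp only [Complex.I_pow_four, hI6]
            ring
        _ ≤ 8 * ((j : ℝ) ^ 2 * |(l : ℝ)|) * (‖a j‖ * ‖b l‖) := by
            rw [norm_mul, norm_neg, norm_mul (a j)]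
            gcongr
        _ = _ := by
            simp
            ring)
  -- `∂ₓ (p₀ₓ uₓ)` is in `L²`, since `|k| |j| |l| ≤ 2 j² l²` for `k = j + l`
  have hW := summable_sq_of_le_convolution
    (A := fun k : ℤ => 2 * ((k : ℝ) ^ 2 * ‖a k‖)) (B := fun l : ℤ => (l : ℝ) ^ 2 * ‖b l‖)
    (fun k => by positivity) (ha.mul_left 2) (fun k => by positivity) hb
    (fun k => (tw k).mul_left (Complex.I * (k : ℂ)))
    (fun k l => by
      obtain ⟨j, rfl⟩ : ∃ j, k = j + l := ⟨k - l, by ring⟩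
      rw [add_sub_cancel_right]
      have h : (|(j : ℝ)| + |(l : ℝ)|) * |(j : ℝ)| * |(l : ℝ)|
          ≤ 2 * ((j : ℝ) ^ 2 * (l : ℝ) ^ 2) := by
        have hj := abs_intCast_le_sq j
        have hl := abs_intCast_le_sq l
        have := mul_le_mul_of_nonneg_left hl (sq_nonneg (j : ℝ))
        have := mul_le_mul_of_nonneg_left hj (sq_nonneg (l : ℝ))
        have hj2 := sq_abs (j : ℝ)
        have hl2 := sq_abs (l : ℝ)
        nlinarith
      calc _ ≤ (|(j : ℝ)| + |(l : ℝ)|) * (|(j : ℝ)| * 1 * ‖a j‖ * (|(l : ℝ)| * ‖b l‖)) := by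
            simp only [norm_mul, norm_neg, Complex.norm_I, one_mul, Complex.norm_intCast]
            push_cast
            rw [← mul_assoc |(j : ℝ)|]
            gcongr
            · exact abs_add_le _ _
            · simpa using norm_sign_le j
        _ = ((|(j : ℝ)| + |(l : ℝ)|) * |(j : ℝ)| * |(l : ℝ)|) * (‖a j‖ * ‖b l‖) := by ring
        _ ≤ 2 * ((j : ℝ) ^ 2 * (l : ℝ) ^ 2) * (‖a j‖ * ‖b l‖) := by gcongr
        _ = _ := by ring)
  have hw' : HasCoeff (Dx (hilbert u₀) * ux)
      (fourierCoeff (Dx (hilbert u₀) * ux)) := .of_memLp hw.memLp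
  have hP := hw'.dx hW.1
  have eR := fun k => (hF.coeff k).trans (by
    rw [(t1 k).tsum_eq, (t2 k).tsum_eq, (t2' k).tsum_eq, (t3 k).tsum_eq, (t3' k).tsum_eq])
  simp_rw [← eR] at hR
  have hD : Summable fun k : ℤ =>
      ‖Complex.I * (k : ℂ) * fourierCoeff (linearizedFlux u₀ u) k‖ ^ 2 := by
    refine ((hR.1.mul_left 2).add (hW.1.mul_left 8)).of_nonneg_of_le (fun _ => sq_nonneg _)
      fun k => ?_
    rw [mul_add]
    set x := Complex.I * (k : ℂ) * fourierCoeff (linearizedFlux u₀ u) k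
    set y := Complex.I * (k : ℂ) * fourierCoeff (Dx (hilbert u₀) * ux) k with hy
    have e : Complex.I * (k : ℂ) * (2 * fourierCoeff (Dx (hilbert u₀) * ux) k)
        = 2 * y := by rw [hy]; ring
    rw [e]
    have h1 : ‖x‖ ≤ ‖x + 2 * y‖ + 2 * ‖y‖ := by
      calc ‖x‖ = ‖x + 2 * y - 2 * y‖ := by congr 1; ring
        _ ≤ _ := (norm_sub_le _ _).trans_eq (by simp)
    nlinarith [norm_nonneg x, sq_nonneg (‖x + 2 * y‖ - 2 * ‖y‖)]
  have hDx := (HasCoeff.of_memLp hF.memLp).dx hD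
  refine ⟨hDx.memLp, _, hw', _, hP, ?_⟩
  have hsum := (hDx.add (hP.const_smul 2)).hasSum_sq
  have h1 := hR.2
  rw [tsum_mul_left, hux.hasSum_sq.tsum_eq] at h1
  refine le_trans (le_of_eq ?_) h1
  refine hsum.tsum_eq.symm.trans (tsum_congr fun k => ?_)
  congr 2
  ring

/-! ### Sobolev norms and Fourier coefficients -/

lemma summable_inv_one_add_abs_sq : Summable fun k : ℤ => ((1 + |(k : ℝ)|)⁻¹) ^ 2 := by
  have h : Summable fun k : ℤ => 1 / (k : ℝ) ^ 2 := Real.summable_one_div_int_pow.2 (by norm_num)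
  refine h.of_norm_bounded_eventually ?_
  refine (Set.finite_singleton (0 : ℤ)).subset fun k hk => ?_
  by_contra hk0
  apply hk
  have hk1 : 0 < |(k : ℝ)| := abs_pos.2 (by exact_mod_cast hk0)
  change ‖((1 + |(k : ℝ)|)⁻¹) ^ 2‖ ≤ 1 / (k : ℝ) ^ 2
  rw [Real.norm_of_nonneg (by positivity), one_div, ← inv_pow, ← sq_abs (k : ℝ)⁻¹, abs_inv]
  gcongr
  linarith

/-- The constant `∑ₖ (1 + |k|)⁻²` of the embedding `H¹ ⊆ ℱ⁻¹ℓ¹`. -/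
noncomputable def sobolevConst : ℝ := ∑' k : ℤ, ((1 + |(k : ℝ)|)⁻¹) ^ 2

lemma sobolevConst_pos : 0 < sobolevConst :=
  summable_inv_one_add_abs_sq.tsum_pos (fun _ => by positivity) 0 (by norm_num)

section Sobolev

variable {f : Torus → ℂ} {m : ℕ} {M : ℝ≥0}

/-- The factor `2π ≥ 1` of `sobolevNorm` is dropped. -/
lemma summable_of_sobolevNorm_le (h : sobolevNorm m f ≤ M) :
    Summable (fun k : ℤ => ((1 + |(k : ℝ)|) ^ m * ‖fourierCoeff f k‖) ^ 2) ∧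
    ∑' k : ℤ, ((1 + |(k : ℝ)|) ^ m * ‖fourierCoeff f k‖) ^ 2 ≤ (M : ℝ) ^ 2 := by
  have e : ∀ k : ℤ, (1 + |(k : ℝ)|) ^ (2 * m) * ‖fourierCoeff f k‖ ^ 2
      = ((1 + |(k : ℝ)|) ^ m * ‖fourierCoeff f k‖) ^ 2 := fun k => by
    rw [mul_pow, ← pow_mul, mul_comm m]
  rw [sobolevNorm] at h
  simp_rw [e] at h
  have h1 := ENNReal.rpow_le_rpow h (by norm_num : (0 : ℝ) ≤ 2)
  rw [← ENNReal.rpow_mul] at h1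
  norm_num at h1
  have h2 : ∑' k : ℤ, ENNReal.ofReal (((1 + |(k : ℝ)|) ^ m * ‖fourierCoeff f k‖) ^ 2)
      ≤ ENNReal.ofReal ((M : ℝ) ^ 2) := by
    rw [ENNReal.ofReal_pow M.coe_nonneg, ENNReal.ofReal_coe_nnreal]
    refine le_trans (le_mul_of_one_le_left' ?_) h1
    have : (1 : ℝ≥0∞) ≤ ENNReal.ofReal Real.pi := by
      rw [ENNReal.one_le_ofReal]
      linarith [Real.pi_gt_three]
    exact one_le_mul (by norm_num) this
  have hs : Summable (fun k : ℤ => ((1 + |(k : ℝ)|) ^ m * ‖fourierCoeff f k‖) ^ 2) := by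
    have := ENNReal.summable_toReal (ne_top_of_le_ne_top ENNReal.ofReal_ne_top h2)
    refine this.congr fun k => ?_
    rw [ENNReal.toReal_ofReal (sq_nonneg _)]
  refine ⟨hs, ?_⟩
  rw [← ENNReal.ofReal_tsum_of_nonneg (fun k => sq_nonneg _) hs] at h2
  exact (ENNReal.ofReal_le_ofReal_iff (sq_nonneg _)).1 h2

/-- One derivative less than the Sobolev norm allows has summable coefficients. The bound comes from
`xy ≤ x² + y²`; it is not linear in `M`, but depends on `M` only. -/
lemma summable_abs_pow_of_sobolevNorm_le (h : sobolevNorm m f ≤ M) {j : ℕ} (hj : j + 1 ≤ m) :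
    Summable (fun k : ℤ => |(k : ℝ)| ^ j * ‖fourierCoeff f k‖) ∧
    ∑' k : ℤ, |(k : ℝ)| ^ j * ‖fourierCoeff f k‖ ≤ sobolevConst + (M : ℝ) ^ 2 := by
  obtain ⟨h1, h2⟩ := summable_of_sobolevNorm_le h
  have le : ∀ k : ℤ, |(k : ℝ)| ^ j * ‖fourierCoeff f k‖
      ≤ ((1 + |(k : ℝ)|)⁻¹) ^ 2 + ((1 + |(k : ℝ)|) ^ m * ‖fourierCoeff f k‖) ^ 2 := fun k => by
    set s := 1 + |(k : ℝ)| with hs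
    have hs1 : 1 ≤ s := by simp [hs]
    calc |(k : ℝ)| ^ j * ‖fourierCoeff f k‖ ≤ s ^ (m - 1) * ‖fourierCoeff f k‖ := by
          gcongr
          exact (pow_le_pow_left₀ (abs_nonneg _) (by simp [hs]) j).trans
            (pow_le_pow_right₀ hs1 (by omega))
      _ = s⁻¹ * (s ^ m * ‖fourierCoeff f k‖) := by
          obtain ⟨n, rfl⟩ : ∃ n, m = n + 1 := ⟨m - 1, by omega⟩
          rw [pow_succ, Nat.add_sub_cancel]
          field_simp
      _ ≤ _ := by
          nlinarith [sq_nonneg (s⁻¹ - s ^ m * ‖fourierCoeff f k‖), sq_nonneg (s⁻¹),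
            sq_nonneg (s ^ m * ‖fourierCoeff f k‖)]
  have hs := (summable_inv_one_add_abs_sq.add h1).of_nonneg_of_le (fun k => by positivity) le
  refine ⟨hs, (hs.tsum_le_tsum le (summable_inv_one_add_abs_sq.add h1)).trans ?_⟩
  rw [summable_inv_one_add_abs_sq.tsum_add h1, sobolevConst]
  gcongr

lemma sobolevNorm_mono {m n : ℕ} (h : m ≤ n) : sobolevNorm m f ≤ sobolevNorm n f := by
  unfold sobolevNorm
  gcongr
  simp

end Sobolev

lemma memLp_toC {f : Torus → ℝ} (hf : MemLp f 2 volume) : MemLp (toC f) 2 haar :=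
  memLp_haarAddCircle_iff.2 hf.ofReal

lemma memLp_toC_of_continuous {f : Torus → ℝ} (hf : Continuous f) : MemLp (toC f) 2 haar :=
  (Complex.continuous_ofReal.comp hf).memLp_of_hasCompactSupport
    (HasCompactSupport.of_compactSpace _)

/-! ### Derivatives on the torus -/

/-- `g` is the classical derivative of the function `f` of class `C¹` on the torus. -/
structure HasTorusDeriv (f g : Torus → ℝ) : Prop where
  continuous : Continuous f
  continuous_deriv : Continuous g
  hasDerivAt : ∀ y : ℝ, HasDerivAt (fun z : ℝ => f (z : Torus)) (g (y : Torus)) y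

lemma HasTorusDeriv.fourierCoeff_eq {f g : Torus → ℝ} (h : HasTorusDeriv f g) (k : ℤ) :
    fourierCoeff (toC g) k = Complex.I * (k : ℂ) * fourierCoeff (toC f) k := by
  rw [fourierCoeff_eq_intervalIntegral _ _ 0, fourierCoeff_eq_intervalIntegral _ _ 0]
  have hc : Continuous fun x : ℝ => fourier (-k) (x : Torus) :=
    (map_continuous (fourier (-k))).comp (AddCircle.continuous_mk' _)
  have hfc : Continuous fun x : ℝ => toC f (x : Torus) :=
    Complex.continuous_ofReal.comp (h.continuous.comp (AddCircle.continuous_mk' _))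
  have hgc : Continuous fun x : ℝ => toC g (x : Torus) :=
    Complex.continuous_ofReal.comp (h.continuous_deriv.comp (AddCircle.continuous_mk' _))
  have key := intervalIntegral.integral_mul_deriv_eq_deriv_mul (a := 0) (b := 0 + 2 * Real.pi)
    (u := fun x : ℝ => fourier (-k) (x : Torus)) (v := fun x : ℝ => toC f (x : Torus))
    (v' := fun x : ℝ => toC g (x : Torus))
    (fun x _ => hasDerivAt_fourier_neg (2 * Real.pi) k x)
    (fun x _ => (h.hasDerivAt x).ofReal_comp)
    (Continuous.intervalIntegrable (by fun_prop) _ _) (hgc.intervalIntegrable _ _)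
  simp only [smul_eq_mul]
  rw [key]
  have e : (((0 + 2 * Real.pi : ℝ)) : Torus) = ((0 : ℝ) : Torus) := by
    rw [AddCircle.coe_add_period]
  rw [e, sub_self, zero_sub, ← intervalIntegral.integral_neg, Complex.real_smul, Complex.real_smul,
    mul_left_comm, ← intervalIntegral.integral_const_mul,
    ← intervalIntegral.integral_const_mul, ← intervalIntegral.integral_const_mul]
  apply intervalIntegral.integral_congr
  intro x _
  have : (Real.pi : ℂ) ≠ 0 := by exact_mod_cast Real.pi_ne_zero
  simp only []
  push_cast
  field_simp

lemma HasTorusDeriv.hasCoeff {f g : Torus → ℝ} (h : HasTorusDeriv f g) :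
    HasCoeff (toC g) (fun k => Complex.I * (k : ℂ) * fourierCoeff (toC f) k) :=
  ⟨memLp_toC_of_continuous h.continuous_deriv, h.fourierCoeff_eq⟩

/-! ### The energy pairing at a fixed time -/

/-- The constant in the bound of the zero order part of `∂ₓ` of the linearized flux. -/
noncomputable def remainderConst (M : ℝ≥0) : ℝ := 8 * (sobolevConst + (M : ℝ) ^ 2)

lemma remainderConst_pos (M : ℝ≥0) : 0 < remainderConst M := by
  have := sobolevConst_pos
  unfold remainderConst
  positivity

/-- The real part of `∂ₓ ℍ[f]`, of Fourier symbol `|k|`. -/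
noncomputable def dxHilbertRe (f : Torus → ℝ) : Torus → ℝ := fun x => (Dx (hilbert (toC f)) x).re

lemma hasCoeff_dx_hilbert {f : Torus → ℝ} (hf : MemLp f 2 volume) {M : ℝ≥0}
    (hM : sobolevNorm 2 (toC f) ≤ M) :
    HasCoeff (Dx (hilbert (toC f))) (fun k => ((|(k : ℝ)| : ℝ) : ℂ) * fourierCoeff (toC f) k) := by
  have e : ∀ k : ℤ, Complex.I * (k : ℂ) * (-Complex.I * (Int.sign k : ℂ) * fourierCoeff (toC f) k)
      = ((|(k : ℝ)| : ℝ) : ℂ) * fourierCoeff (toC f) k := fun k => by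
    have h1 : ((k * k.sign : ℤ) : ℂ) = ((|k| : ℤ) : ℂ) := by 
      rw [Int.mul_sign_self, Int.abs_eq_natAbs]
    have h2 : ((|(k : ℝ)| : ℝ) : ℂ) = ((|k| : ℤ) : ℂ) := by
      rw [← Int.cast_abs, Complex.ofReal_intCast]
    rw [h2, ← h1]
    push_cast
    linear_combination (-(k : ℂ) * (k.sign : ℂ) * fourierCoeff (toC f) k) * Complex.I_sq
  refine ((HasCoeff.of_memLp (memLp_toC hf)).hilbert.dx ?_).congr e
  simp_rw [e]
  refine (summable_of_sobolevNorm_le hM).1.of_nonneg_of_le (fun _ => sq_nonneg _) fun k => ?_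
  rw [norm_mul]
  gcongr
  rw [Complex.norm_real, norm_abs_eq_norm, Real.norm_eq_abs]
  nlinarith [abs_nonneg (k : ℝ)]

lemma memLp_ofReal_re {f : Torus → ℂ} (hf : MemLp f 2 haar) : MemLp (fun x => (f x).re) 2 haar :=
  hf.re

lemma integrable_mul_of_continuous {f g : Torus → ℝ} (hf : Continuous f) (hg : MemLp g 2 haar) :
    Integrable (fun x => f x * g x) haar := by
  have hf2 : MemLp f 2 haar :=
    hf.memLp_of_hasCompactSupport (HasCompactSupport.of_compactSpace _)
  exact hf2.integrable_mul hg

/-- Young's inequality for the pairing of real and complex functions in `L²(𝕋)`. -/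
lemma integral_mul_re_le {v : Torus → ℝ} {f : Torus → ℂ} (hv : Continuous v) (hf : MemLp f 2 haar)
    {ε : ℝ} (hε : 0 < ε) :
    ∫ x, v x * (f x).re ∂haar
      ≤ ε * ∫ x, v x ^ 2 ∂haar + (4 * ε)⁻¹ * ∫ x, ‖f x‖ ^ 2 ∂haar := by
  have hv2 : MemLp v 2 haar :=
    hv.memLp_of_hasCompactSupport (HasCompactSupport.of_compactSpace _)
  have i1 : Integrable (fun x => ε * v x ^ 2) haar := hv2.integrable_sq.const_mul _
  have i2 : Integrable (fun x => (4 * ε)⁻¹ * ‖f x‖ ^ 2) haar := hf.norm.integrable_sq.const_mul _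
  rw [← integral_const_mul, ← integral_const_mul, ← integral_add i1 i2]
  refine integral_mono (integrable_mul_of_continuous hv (memLp_ofReal_re hf)) (i1.add i2)
    fun x => ?_
  have h1 : (f x).re ^ 2 ≤ ‖f x‖ ^ 2 := by
    rw [← sq_abs]
    gcongr
    exact Complex.abs_re_le_norm _
  have h2 : v x * (f x).re ≤ ε * v x ^ 2 + (4 * ε)⁻¹ * (f x).re ^ 2 := by
    have : ε * v x ^ 2 + (4 * ε)⁻¹ * (f x).re ^ 2 - v x * (f x).re
        = ε * (v x - (2 * ε)⁻¹ * (f x).re) ^ 2 := by field_simp; ring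
    have := mul_nonneg hε.le (sq_nonneg (v x - (2 * ε)⁻¹ * (f x).re))
    linarith
  have h3 : (4 * ε)⁻¹ * (f x).re ^ 2 ≤ (4 * ε)⁻¹ * ‖f x‖ ^ 2 := by gcongr
  simp only
  linarith

/-- The pairing of `v` with the spatial part of the linearized operator: up to the square of the
`L²` norms of `v` and `uₓ` it reduces to the pairing with `2 (p₀ₓ uₓ)ₓ`. -/
lemma pairing_le {u₀ u ux uxx v vx g : Torus → ℝ} {M : ℝ≥0}
    (h₀ : MemLp u₀ 2 volume) (hM : sobolevNorm 3 (toC u₀) ≤ M)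
    (hu : HasTorusDeriv u ux) (hux : HasTorusDeriv ux uxx) (hv : HasTorusDeriv v vx)
    (hg : Continuous g) {ε : ℝ} (hε : 0 < ε) :
    MemLp (fun x => (g x : ℂ) - Dx (linearizedFlux (toC u₀) (toC u)) x) 2 haar ∧
    ∫ x, v x * g x ∂haar - 2 * ∫ x, dxHilbertRe u₀ x * (vx x * ux x) ∂haar
      ≤ ε * ∫ x, v x ^ 2 ∂haar
        + (4 * ε)⁻¹ * ∫ x, ‖(g x : ℂ) - Dx (linearizedFlux (toC u₀) (toC u)) x‖ ^ 2 ∂haar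
        + remainderConst M / 2 * (∫ x, v x ^ 2 ∂haar + ∫ x, ux x ^ 2 ∂haar) := by
  have hL₀ := HasCoeff.of_memLp (memLp_toC h₀)
  have hLu := HasCoeff.of_memLp (memLp_toC_of_continuous hu.continuous)
  obtain ⟨s1, s2⟩ := summable_abs_pow_of_sobolevNorm_le hM (j := 2) le_rfl
  simp only [sq_abs] at s1 s2
  have s3 : Summable fun k : ℤ => ((k : ℝ) ^ 2 * ‖fourierCoeff (toC u₀) k‖) ^ 2 := by
    refine (summable_of_sobolevNorm_le hM).1.of_nonneg_of_le (fun _ => sq_nonneg _) fun k => ?_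
    gcongr
    calc (k : ℝ) ^ 2 = |(k : ℝ)| ^ 2 := (sq_abs _).symm
      _ ≤ (1 + |(k : ℝ)|) ^ 2 := by gcongr; simp
      _ ≤ (1 + |(k : ℝ)|) ^ 3 := pow_le_pow_right₀ (by simp) (by norm_num)
  have s4 : Summable fun k : ℤ => ((k : ℝ) ^ 2 * ‖fourierCoeff (toC u) k‖) ^ 2 := by
    refine hux.hasCoeff.hasSum_sq.summable.congr fun k => ?_
    rw [hu.fourierCoeff_eq]
    simp only [norm_mul, Complex.norm_I, one_mul, Complex.norm_intCast]
    rw [← sq_abs (k : ℝ)]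
    ring
  obtain ⟨hF, w, hw, P, hP, hR⟩ := linearizedFlux_structure hL₀ hLu hu.hasCoeff s1 s3 s4
  set F := Dx (linearizedFlux (toC u₀) (toC u))
  set D := remainderConst M with hD
  have hDpos : 0 < D := remainderConst_pos M
  have hG : MemLp (fun x => (g x : ℂ) - F x) 2 haar := (memLp_toC_of_continuous hg).sub hF
  have hR' : MemLp (fun x => F x + 2 * P x) 2 haar := hF.add (hP.memLp.const_smul (2 : ℂ))
  refine ⟨hG, ?_⟩
  -- integration by parts, by Parseval's identity
  have ibp : ∫ x, v x * (P x).re ∂haar = - ∫ x, dxHilbertRe u₀ x * (vx x * ux x) ∂haar := by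
    have hLv := HasCoeff.of_memLp (memLp_toC_of_continuous hv.continuous)
    have p1 := hLv.hasSum_mul hP
    have p2 := (hv.hasCoeff.hasSum_mul hw).neg
    have p3 : ∫ x, toC v x * P x ∂haar
        = - ∫ x, toC vx x * (Dx (hilbert (toC u₀)) * toC ux) x ∂haar := by
      refine p1.unique (p2.congr_fun fun k => ?_)
      push_cast
      ring
    have p4 := congrArg Complex.re p3
    rw [Complex.neg_re, ← RCLike.re_eq_complex_re, ← integral_re, ← integral_re] at p4
    · have e2 : ∀ x, dxHilbertRe u₀ x * (vx x * ux x)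
          = RCLike.re (toC vx x * (Dx (hilbert (toC u₀)) * toC ux) x) := fun x => by
        simp [toC, dxHilbertRe]
        ring
      have e3 : ∀ x, v x * (P x).re = RCLike.re (toC v x * P x) := fun x => by simp [toC]
      simp_rw [e2, e3]
      exact p4
    · exact (memLp_toC_of_continuous hv.continuous_deriv).integrable_mul hw.memLp
    · exact (memLp_toC_of_continuous hv.continuous).integrable_mul hP.memLp
  -- `g = (g - F) + (F + 2 P) - 2 P`
  have e1 : ∫ x, v x * g x ∂haar = ∫ x, v x * ((g x : ℂ) - F x).re ∂haar
      + ∫ x, v x * (F x + 2 * P x).re ∂haar - 2 * ∫ x, v x * (P x).re ∂haar := by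
    have i1 := integrable_mul_of_continuous hv.continuous (memLp_ofReal_re hG)
    have i2 := integrable_mul_of_continuous hv.continuous (memLp_ofReal_re hR')
    have i3 := integrable_mul_of_continuous hv.continuous (memLp_ofReal_re hP.memLp)
    have i12 : Integrable (fun x => v x * ((g x : ℂ) - F x).re + v x * (F x + 2 * P x).re) haar :=
      i1.add i2
    rw [← integral_const_mul, ← integral_add i1 i2, ← integral_sub i12 (i3.const_mul 2)]
    congr 1
    ext x
    simp
    ring
  have b1 := integral_mul_re_le hv.continuous hG hε
  have b2 := integral_mul_re_le hv.continuous hR' (ε := D / 2) (by positivity)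
  have b3 : ∫ x, ‖F x + 2 * P x‖ ^ 2 ∂haar ≤ D ^ 2 * ∫ x, ux x ^ 2 ∂haar := by
    refine hR.trans ?_
    have : ∀ x, ‖toC ux x‖ ^ 2 = ux x ^ 2 := fun x => by simp [toC]
    simp_rw [this]
    refine mul_le_mul_of_nonneg_right ?_ (integral_nonneg fun x => sq_nonneg _)
    have h0 : 0 ≤ ∑' k : ℤ, (k : ℝ) ^ 2 * ‖fourierCoeff (toC u₀) k‖ :=
      tsum_nonneg fun k => by positivity
    rw [hD, remainderConst]
    gcongr
  have b4 : (4 * (D / 2))⁻¹ * ∫ x, ‖F x + 2 * P x‖ ^ 2 ∂haar ≤ D / 2 * ∫ x, ux x ^ 2 ∂haar := by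
    refine (mul_le_mul_of_nonneg_left b3 (by positivity)).trans_eq ?_
    field_simp
    ring
  rw [e1, ibp]
  linarith

/-! ### Weak derivatives on the line -/

open Filter Topology in
/-- Mollification of a compactly supported function of class `C¹`, by smooth functions supported in
a common compact set, which converge together with their derivatives and stay bounded. -/
lemma exists_smooth_approx {η : ℝ → ℝ} (hη : ContDiff ℝ 1 η) (hc : HasCompactSupport η) :
    ∃ (e : ℕ → ℝ → ℝ) (K : Set ℝ) (C : ℝ), IsCompact K ∧
      (∀ n, ContDiff ℝ ∞ (e n)) ∧ (∀ n, HasCompactSupport (e n)) ∧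
      (∀ n, ∀ t, t ∉ K → e n t = 0 ∧ deriv (e n) t = 0) ∧
      (∀ n, ∀ t, |e n t| ≤ C ∧ |deriv (e n) t| ≤ C) ∧
      (∀ t, Tendsto (fun n => e n t) atTop (𝓝 (η t))) ∧
      (∀ t, Tendsto (fun n => deriv (e n) t) atTop (𝓝 (deriv η t))) := by
  have hd : Continuous (deriv η) := hη.continuous_deriv le_rfl
  have hcd : HasCompactSupport (deriv η) := hc.deriv
  obtain ⟨C₁, hC₁⟩ := hη.continuous.bounded_above_of_compact_support hc
  obtain ⟨C₂, hC₂⟩ := hd.bounded_above_of_compact_support hcd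
  let φ : ℕ → ContDiffBump (0 : ℝ) := fun n =>
    ⟨(1 / ((n : ℝ) + 1)) / 2, 1 / ((n : ℝ) + 1), by positivity, by
      have : 0 < 1 / ((n : ℝ) + 1) := by positivity
      linarith⟩
  have hφ : Tendsto (fun n => (φ n).rOut) atTop (𝓝 0) := tendsto_one_div_add_atTop_nhds_zero_nat
  have hφ1 : ∀ n, (φ n).rOut ≤ 1 := fun n => by
    change 1 / ((n : ℝ) + 1) ≤ 1
    rw [div_le_one (by positivity)]
    linarith [Nat.cast_nonneg (α := ℝ) n]
  let L := ContinuousLinearMap.lsmul ℝ ℝ (E := ℝ)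
  let e : ℕ → ℝ → ℝ := fun n => convolution ((φ n).normed volume) η L volume
  have hder : ∀ n, deriv (e n) = convolution ((φ n).normed volume) (deriv η) L volume := fun n => by
    ext t
    exact (hc.hasDerivAt_convolution_right L
      ((φ n).continuous_normed.locallyIntegrable) hη t).deriv
  -- a mollification differs from `g` by at most the oscillation of `g`
  have hbound : ∀ (g : ℝ → ℝ) (C : ℝ), Continuous g → (∀ t, ‖g t‖ ≤ C) → ∀ n t,
      |convolution ((φ n).normed volume) g L volume t| ≤ 3 * C := fun g C hg hC n t => by
    have h1 := (φ n).dist_normed_convolution_le (x₀ := t) (μ := volume) (ε := 2 * C)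
      hg.aestronglyMeasurable (fun x _ => by
        rw [dist_eq_norm]
        linarith [norm_sub_le (g x) (g t), hC x, hC t])
    rw [dist_eq_norm] at h1
    have h2 := norm_sub_norm_le (convolution ((φ n).normed volume) g L volume t) (g t)
    have h3 := hC t
    rw [← Real.norm_eq_abs]
    linarith
  refine ⟨e, Metric.cthickening 1 (tsupport η), max (3 * C₁) (3 * C₂), hc.isCompact.cthickening,
    fun n => ?_, fun n => ?_, ?_, fun n t => ?_, fun t => ?_, fun t => ?_⟩
  · exact (φ n).hasCompactSupport_normed.contDiff_convolution_left L (φ n).contDiff_normed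
      hη.continuous.locallyIntegrable
  · exact (φ n).hasCompactSupport_normed.convolution L hc
  · have hz : ∀ (g : ℝ → ℝ), tsupport g ⊆ tsupport η → ∀ n t,
        t ∉ Metric.cthickening 1 (tsupport η) →
        convolution ((φ n).normed volume) g L volume t = 0 := fun g hg n t ht => by
      by_contra h0
      apply ht
      obtain ⟨x, hx, y, hy, rfl⟩ := support_convolution_subset L h0
      rw [(φ n).support_normed_eq, mem_ball_zero_iff] at hx
      refine Metric.mem_cthickening_of_dist_le _ y _ _ (hg (subset_tsupport _ hy)) ?_
      rw [dist_eq_norm]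
      simp only [add_sub_cancel_right]
      exact hx.le.trans (hφ1 n)
    intro n t ht
    refine ⟨hz η le_rfl n t ht, ?_⟩
    rw [hder]
    exact hz _ (tsupport_deriv_subset) n t ht
  · rw [hder]
    exact ⟨(hbound η C₁ hη.continuous hC₁ n t).trans (le_max_left _ _),
      (hbound _ C₂ hd hC₂ n t).trans (le_max_right _ _)⟩
  · exact ContDiffBump.convolution_tendsto_right_of_continuous hφ hη.continuous t
  · simp_rw [hder]
    exact ContDiffBump.convolution_tendsto_right_of_continuous hφ hd t

open Filter Topology in
/-- A weak derivative on the line can be tested against functions of class `C¹`. -/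
lemma weak_deriv_contDiff_one {F G : ℝ → ℂ} (hF : LocallyIntegrable F) (hG : LocallyIntegrable G)
    (h : ∀ η : ℝ → ℝ, ContDiff ℝ ∞ η → HasCompactSupport η →
      ∫ t, ((deriv η t : ℝ) : ℂ) * F t = - ∫ t, (η t : ℂ) * G t)
    {η : ℝ → ℝ} (hη : ContDiff ℝ 1 η) (hc : HasCompactSupport η) :
    ∫ t, ((deriv η t : ℝ) : ℂ) * F t = - ∫ t, (η t : ℂ) * G t := by
  obtain ⟨e, K, C, hK, he, hec, hzero, hbd, hlim, hlimd⟩ := exists_smooth_approx hη hc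
  have conv : ∀ (H : ℝ → ℂ), LocallyIntegrable H → ∀ (g : ℕ → ℝ → ℝ) (g' : ℝ → ℝ),
      (∀ n, Continuous (g n)) → (∀ n t, t ∉ K → g n t = 0) → (∀ n t, |g n t| ≤ C) →
      (∀ t, Tendsto (fun n => g n t) atTop (𝓝 (g' t))) →
      Tendsto (fun n => ∫ t, (g n t : ℂ) * H t) atTop (𝓝 (∫ t, (g' t : ℂ) * H t)) := by
    intro H hH g g' hg hg0 hgC hgl
    refine tendsto_integral_of_dominated_convergence (K.indicator fun t => C * ‖H t‖)
      (fun n => ?_) ?_ (fun n => ae_of_all _ fun t => ?_) (ae_of_all _ fun t => ?_)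
    · exact (Complex.continuous_ofReal.comp (hg n)).aestronglyMeasurable.mul
        hH.aestronglyMeasurable
    · rw [integrable_indicator_iff hK.measurableSet]
      exact ((hH.integrableOn_isCompact hK).norm).const_mul C
    · by_cases ht : t ∈ K
      · rw [Set.indicator_of_mem ht, norm_mul, Complex.norm_real, Real.norm_eq_abs]
        gcongr
        exact hgC n t
      · rw [Set.indicator_of_notMem ht, hg0 n t ht]
        simp
    · exact ((Complex.continuous_ofReal.tendsto _).comp (hgl t)).mul_const _
  have c1 := conv F hF (fun n => deriv (e n)) (deriv η)
    (fun n => (he n).continuous_deriv (by simp)) (fun n t ht => (hzero n t ht).2)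
    (fun n t => (hbd n t).2) hlimd
  have c2 := conv G hG e η (fun n => (he n).continuous) (fun n t ht => (hzero n t ht).1)
    (fun n t => (hbd n t).1) hlim
  refine tendsto_nhds_unique c1 (c2.neg.congr fun n => ?_)
  exact (h (e n) (he n) (hec n)).symm

/-- Complex-valued test functions. -/
lemma weak_deriv_contDiff_one_complex {F G : ℝ → ℂ} (hF : LocallyIntegrable F)
    (hG : LocallyIntegrable G)
    (h : ∀ η : ℝ → ℝ, ContDiff ℝ ∞ η → HasCompactSupport η →
      ∫ t, ((deriv η t : ℝ) : ℂ) * F t = - ∫ t, (η t : ℂ) * G t)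
    {ψ : ℝ → ℂ} (hψ : ContDiff ℝ 1 ψ) (hc : HasCompactSupport ψ) :
    ∫ t, deriv ψ t * F t = - ∫ t, ψ t * G t := by
  have hre : ContDiff ℝ 1 fun t => (ψ t).re := Complex.reCLM.contDiff.comp hψ
  have him : ContDiff ℝ 1 fun t => (ψ t).im := Complex.imCLM.contDiff.comp hψ
  have hcre : HasCompactSupport fun t => (ψ t).re := hc.comp_left (g := Complex.re) rfl
  have hcim : HasCompactSupport fun t => (ψ t).im := hc.comp_left (g := Complex.im) rfl
  have dψ : ∀ t, HasDerivAt ψ (deriv ψ t) t := fun t =>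
    (hψ.differentiable (by norm_num) t).hasDerivAt
  have dre : ∀ t, deriv (fun t => (ψ t).re) t = (deriv ψ t).re := fun t =>
    (Complex.reCLM.hasFDerivAt.comp_hasDerivAt t (dψ t)).deriv
  have dim : ∀ t, deriv (fun t => (ψ t).im) t = (deriv ψ t).im := fun t =>
    (Complex.imCLM.hasFDerivAt.comp_hasDerivAt t (dψ t)).deriv
  have int : ∀ (a : ℝ → ℝ) (H : ℝ → ℂ), Continuous a → HasCompactSupport a →
      LocallyIntegrable H → Integrable fun t => (a t : ℂ) * H t := fun a H ha hac hH => by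
    have := hH.integrable_smul_left_of_hasCompactSupport ha hac
    simpa using this
  have split : ∀ (f H : ℝ → ℂ), Continuous f → HasCompactSupport f → LocallyIntegrable H →
      ∫ t, f t * H t = (∫ t, ((f t).re : ℂ) * H t) + Complex.I * ∫ t, ((f t).im : ℂ) * H t := by
    intro f H hf hfc hH
    have i1 := int (fun t => (f t).re) H (Complex.continuous_re.comp hf)
      (hfc.comp_left (g := Complex.re) rfl) hH
    have i2 := int (fun t => (f t).im) H (Complex.continuous_im.comp hf)
      (hfc.comp_left (g := Complex.im) rfl) hH
    rw [← integral_const_mul, ← integral_add i1 (i2.const_mul _)]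
    congr 1
    ext t
    conv_lhs => rw [← Complex.re_add_im (f t)]
    ring
  have h1 := weak_deriv_contDiff_one hF hG h hre hcre
  have h2 := weak_deriv_contDiff_one hF hG h him hcim
  simp_rw [dre] at h1
  simp_rw [dim] at h2
  rw [split _ _ (hψ.continuous_deriv le_rfl) hc.deriv hF, split _ _ hψ.continuous hc hG, h1, h2]
  ring

/-! ### Fourier modes of functions of time and space -/

/-- A measurable function on `ℝ × 𝕋` whose `Hᵐ(𝕋)` norm is at most `M` at almost every time. -/
structure BddInSobolev (m : ℕ) (M : ℝ≥0) (f : ℝ → Torus → ℝ) : Prop where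
  aestronglyMeasurable : AEStronglyMeasurable (fun p : ℝ × Torus => f p.1 p.2) (volume.prod volume)
  memLp : ∀ᵐ t : ℝ, MemLp (f t) 2 volume
  norm_le : ∀ᵐ t : ℝ, sobolevNorm m (toC (f t)) ≤ M

lemma MemLinftySobolev.bddInSobolev {m : ℕ} {M : ℝ≥0} {f : ℝ → Torus → ℝ}
    (hf : MemLinftySobolev m f) (hM : linftySobolevNorm m f ≤ M) : BddInSobolev m M f :=
  ⟨hf.1, hf.2.1, (ENNReal.ae_le_essSup _).mono fun _ h => h.trans hM⟩

namespace BddInSobolev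

variable {m : ℕ} {M : ℝ≥0} {f : ℝ → Torus → ℝ}

lemma mono (hf : BddInSobolev m M f) {n : ℕ} (h : n ≤ m) : BddInSobolev n M f :=
  ⟨hf.1, hf.2, hf.3.mono fun _ ht => (sobolevNorm_mono h).trans ht⟩

lemma aestronglyMeasurable_coeff (hf : BddInSobolev m M f) (k : ℤ) :
    AEStronglyMeasurable (fun t => fourierCoeff (toC (f t)) k) volume := by
  have h : AEStronglyMeasurable (fun p : ℝ × Torus => fourier (-k) p.2 • toC (f p.1) p.2)
      (volume.prod volume) :=
    (((map_continuous (fourier (-k))).comp continuous_snd).aestronglyMeasurable).smul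
      (Complex.continuous_ofReal.comp_aestronglyMeasurable hf.aestronglyMeasurable)
  simp_rw [fourierCoeff, AddCircle.integral_haarAddCircle]
  exact h.integral_prod_right'.const_smul _

lemma norm_coeff_le {f : Torus → ℂ} (h : sobolevNorm m f ≤ M) (k : ℤ) :
    ‖fourierCoeff f k‖ ≤ M := by
  obtain ⟨h1, h2⟩ := summable_of_sobolevNorm_le h
  have h3 := (h1.le_tsum k fun _ _ => sq_nonneg _).trans h2
  have h4 := abs_le_of_sq_le_sq h3 M.coe_nonneg
  refine le_trans ?_ ((le_abs_self _).trans h4)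
  exact le_mul_of_one_le_left (norm_nonneg _) (one_le_pow₀ (by simp))

lemma locallyIntegrable_coeff (hf : BddInSobolev m M f) (k : ℤ) :
    LocallyIntegrable (fun t => fourierCoeff (toC (f t)) k) volume :=
  (memLp_top_of_bound (hf.aestronglyMeasurable_coeff k) M
    (hf.norm_le.mono fun _ ht => norm_coeff_le ht k)).locallyIntegrable le_top

lemma integral_norm_le {f : Torus → ℝ} (hf : MemLp f 2 volume)
    (h : sobolevNorm m (toC f) ≤ M) : ∫ x, ‖f x‖ ≤ 2 * Real.pi * (1 + (M : ℝ) ^ 2) := by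
  have hL := HasCoeff.of_memLp (memLp_toC hf)
  obtain ⟨h1, h2⟩ := summable_of_sobolevNorm_le h
  have h3 : ∫ x, ‖toC f x‖ ^ 2 ∂haar ≤ (M : ℝ) ^ 2 := by
    rw [← hL.hasSum_sq.tsum_eq]
    refine (hL.hasSum_sq.summable.tsum_le_tsum (fun k => ?_) h1).trans h2
    gcongr
    exact le_mul_of_one_le_left (norm_nonneg _) (one_le_pow₀ (by simp))
  have h4 : ∫ x, ‖toC f x‖ ∂haar ≤ 1 + (M : ℝ) ^ 2 := by
    have i2 : Integrable (fun x => ‖toC f x‖ ^ 2) haar := hL.memLp.norm.integrable_sq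
    calc ∫ x, ‖toC f x‖ ∂haar ≤ ∫ x, (1 + ‖toC f x‖ ^ 2) ∂haar := by
          refine integral_mono hL.integrable.norm ((integrable_const _).add i2) fun x => ?_
          simp only
          nlinarith [sq_nonneg (‖toC f x‖ - 1)]
      _ ≤ _ := by
          rw [integral_add (integrable_const _) i2]
          simpa using h3
  rw [AddCircle.integral_haarAddCircle, smul_eq_mul, inv_mul_le_iff₀ Real.two_pi_pos] at h4
  refine le_trans (le_of_eq ?_) h4
  congr 1
  ext x
  simp [toC]

lemma integrable_test_mul (hf : BddInSobolev m M f) {η : ℝ → ℝ} (hη : Continuous η)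
    (hc : HasCompactSupport η) (k : ℤ) :
    Integrable (fun p : ℝ × Torus => (fourier (-k) p.2 : ℂ) * ((η p.1 * f p.1 p.2 : ℝ) : ℂ))
      (volume.prod volume) := by
  have hm : AEStronglyMeasurable (fun p : ℝ × Torus => η p.1 * f p.1 p.2)
      (volume.prod volume) :=
    (hη.comp continuous_fst).aestronglyMeasurable.mul hf.aestronglyMeasurable
  have h1 : Integrable (fun p : ℝ × Torus => η p.1 * f p.1 p.2) (volume.prod volume) := by
    rw [integrable_prod_iff hm]
    refine ⟨?_, ?_⟩
    · filter_upwards [hf.memLp] with t ht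
      have hi : Integrable (f t) volume := ht.integrable one_le_two
      exact hi.const_mul (η t)
    have hm' : AEStronglyMeasurable (fun t => ∫ x, ‖η t * f t x‖) volume :=
      hm.norm.integral_prod_right'
    have hb : Integrable (fun t => ‖η t‖ * (2 * Real.pi * (1 + (M : ℝ) ^ 2))) :=
      (hη.integrable_of_hasCompactSupport hc).norm.mul_const _
    refine hb.mono' hm' ?_
    filter_upwards [hf.memLp, hf.norm_le] with t h1 h2
    rw [Real.norm_of_nonneg (integral_nonneg fun _ => norm_nonneg _)]
    simp_rw [norm_mul]
    rw [integral_const_mul]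
    gcongr
    exact integral_norm_le h1 h2
  refine (h1.ofReal (𝕜 := ℂ)).mono ?_ ?_
  · exact ((map_continuous (fourier (-k))).comp continuous_snd).aestronglyMeasurable.mul
      (Complex.continuous_ofReal.comp_aestronglyMeasurable hm)
  · refine ae_of_all _ fun p => ?_
    rw [norm_mul, fourier_apply, Circle.norm_coe, one_mul]
    rfl

/-- Fubini's theorem: a mode of `f` integrated in time is a mode of the integral in time of `f`. -/
lemma integral_test_mul_coeff (hf : BddInSobolev m M f) {η : ℝ → ℝ} (hη : Continuous η)
    (hc : HasCompactSupport η) (k : ℤ) :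
    ∫ t, (η t : ℂ) * fourierCoeff (toC (f t)) k
      = (2 * Real.pi)⁻¹ • ∫ x : Torus, (fourier (-k) x : ℂ) * ((∫ t, η t * f t x : ℝ) : ℂ) := by
  have hswap := integral_integral_swap
    (f := fun (t : ℝ) (x : Torus) => (fourier (-k) x : ℂ) * ((η t * f t x : ℝ) : ℂ))
    (hf.integrable_test_mul hη hc k)
  simp_rw [integral_const_mul, integral_complex_ofReal] at hswap
  rw [← hswap, ← integral_smul]
  congr 1
  ext t
  rw [fourierCoeff, AddCircle.integral_haarAddCircle, mul_smul_comm, ← integral_const_mul]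
  congr 2
  ext x
  simp only [toC, smul_eq_mul]
  push_cast
  ring

/-- Every mode of `g = ∂ₜ f` is the weak derivative of the mode of `f`. -/
lemma integral_deriv_mul_coeff {n : ℕ} {N : ℝ≥0} {g : ℝ → Torus → ℝ} (hf : BddInSobolev m M f)
    (hg : BddInSobolev n N g) (hfg : IsWeakTimeDeriv f g) (k : ℤ) {ψ : ℝ → ℂ}
    (hψ : ContDiff ℝ 1 ψ) (hc : HasCompactSupport ψ) :
    ∫ t, deriv ψ t * fourierCoeff (toC (f t)) k = - ∫ t, ψ t * fourierCoeff (toC (g t)) k := by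
  refine weak_deriv_contDiff_one_complex (hf.locallyIntegrable_coeff k)
    (hg.locallyIntegrable_coeff k) (fun η hη hηc => ?_) hψ hc
  rw [hf.integral_test_mul_coeff (hη.continuous_deriv (by simp)) hηc.deriv,
    hg.integral_test_mul_coeff hη.continuous hηc, ← smul_neg, ← integral_neg]
  congr 1
  apply integral_congr_ae
  filter_upwards [hfg η hη hηc] with x hx
  rw [hx]
  push_cast
  ring

end BddInSobolev

/-! ### The pairing with `|D|f` -/

/-- The pairing `∫ (|D|f) w dx / 2π`, where `|D| = ∂ₓ ℍ`, written with Fourier coefficients. -/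
noncomputable def absPairing (f w : Torus → ℝ) : ℝ :=
  ∑' k : ℤ, |(k : ℝ)| * (fourierCoeff (toC w) (-k) * fourierCoeff (toC f) k).re

section fixedTime

variable {f w : Torus → ℝ} {M : ℝ≥0}

lemma norm_fourierCoeff_le (w : Torus → ℝ) (k : ℤ) :
    ‖fourierCoeff (toC w) k‖ ≤ ∫ x, |w x| ∂haar := by
  refine (norm_integral_le_integral_norm _).trans_eq ?_
  congr 1
  ext x
  rw [norm_smul, fourier_apply, Circle.norm_coe, one_mul]
  simp [toC]

lemma norm_absPairing_term_le (f w : Torus → ℝ) (k : ℤ) :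
    ‖|(k : ℝ)| * (fourierCoeff (toC w) (-k) * fourierCoeff (toC f) k).re‖
      ≤ |(k : ℝ)| ^ 1 * ‖fourierCoeff (toC f) k‖ * ∫ x, |w x| ∂haar := by
  rw [norm_mul, Real.norm_eq_abs, abs_abs, Real.norm_eq_abs, pow_one, mul_assoc]
  gcongr
  refine (Complex.abs_re_le_norm _).trans ?_
  rw [norm_mul, mul_comm]
  gcongr
  exact norm_fourierCoeff_le w (-k)

lemma summable_absPairing (hM : sobolevNorm 2 (toC f) ≤ M) (w : Torus → ℝ) :
    Summable (fun k : ℤ => ‖|(k : ℝ)| * (fourierCoeff (toC w) (-k) * fourierCoeff (toC f) k).re‖) ∧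
    ∑' k : ℤ, ‖|(k : ℝ)| * (fourierCoeff (toC w) (-k) * fourierCoeff (toC f) k).re‖
      ≤ (sobolevConst + (M : ℝ) ^ 2) * ∫ x, |w x| ∂haar := by
  obtain ⟨h1, h2⟩ := summable_abs_pow_of_sobolevNorm_le hM (j := 1) le_rfl
  have hs := (h1.mul_right (∫ x, |w x| ∂haar)).of_nonneg_of_le (fun _ => norm_nonneg _)
    (norm_absPairing_term_le f w)
  refine ⟨hs, (hs.tsum_le_tsum (norm_absPairing_term_le f w) (h1.mul_right _)).trans ?_⟩
  rw [tsum_mul_right]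
  have : 0 ≤ ∫ x, |w x| ∂haar := integral_nonneg fun _ => abs_nonneg _
  gcongr

lemma abs_absPairing_le (hM : sobolevNorm 2 (toC f) ≤ M) (w : Torus → ℝ) :
    |absPairing f w| ≤ (sobolevConst + (M : ℝ) ^ 2) * ∫ x, |w x| ∂haar := by
  obtain ⟨h1, h2⟩ := summable_absPairing hM w
  exact (norm_tsum_le_tsum_norm h1).trans h2

lemma integral_dxHilbertRe_mul (hf : MemLp f 2 volume) (hM : sobolevNorm 2 (toC f) ≤ M)
    (hw : Continuous w) : ∫ x, dxHilbertRe f x * w x ∂haar = absPairing f w := by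
  have h1 := hasCoeff_dx_hilbert hf hM
  have h2 := HasCoeff.of_memLp (memLp_toC_of_continuous hw)
  have h3 := Complex.hasSum_re (h2.hasSum_mul h1)
  have hi : Integrable (fun x => toC w x * Dx (hilbert (toC f)) x) haar :=
    h2.memLp.integrable_mul h1.memLp
  rw [← RCLike.re_eq_complex_re, ← integral_re hi] at h3
  have e : ∀ x, dxHilbertRe f x * w x = RCLike.re (toC w x * Dx (hilbert (toC f)) x) := fun x => by
    simp [toC, dxHilbertRe, mul_comm]
  simp_rw [e]
  rw [← h3.tsum_eq, absPairing]
  refine tsum_congr fun k => ?_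
  rw [mul_left_comm]
  simp

end fixedTime

lemma aestronglyMeasurable_tsum {G : ℤ → ℝ → ℝ} (hG : ∀ k, AEStronglyMeasurable (G k) volume)
    (hs : ∀ᵐ t, Summable fun k => G k t) : AEStronglyMeasurable (fun t => ∑' k, G k t) volume := by
  refine aestronglyMeasurable_of_tendsto_ae Filter.atTop
    (f := fun (s : Finset ℤ) t => ∑ k ∈ s, G k t) (fun s => ?_) ?_
  · exact Finset.aestronglyMeasurable_fun_sum s fun k _ => hG k
  · filter_upwards [hs] with t ht
    exact ht.hasSum

/-- Integration of a series of functions whose sum of norms is dominated. -/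
lemma hasSum_integral_of_tsum_norm_le {F : ℤ → ℝ → ℝ}
    (hm : ∀ k, AEStronglyMeasurable (F k) volume) (hs : ∀ᵐ t, Summable fun k => ‖F k t‖)
    {B : ℝ → ℝ} (hB : Integrable B) (hle : ∀ᵐ t, ∑' k, ‖F k t‖ ≤ B t) :
    Integrable (fun t => ∑' k, F k t) ∧ HasSum (fun k => ∫ t, F k t) (∫ t, ∑' k, F k t) := by
  have i1 : Integrable (fun t => ∑' k, ‖F k t‖) := by
    refine hB.mono' (aestronglyMeasurable_tsum (fun k => (hm k).norm) hs) ?_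
    filter_upwards [hle] with t ht
    rwa [Real.norm_of_nonneg (tsum_nonneg fun _ => norm_nonneg _)]
  refine ⟨?_, ?_⟩
  · refine hB.mono' (aestronglyMeasurable_tsum hm (hs.mono fun t ht => ht.of_norm)) ?_
    filter_upwards [hle, hs] with t ht hst
    exact (norm_tsum_le_tsum_norm hst).trans ht
  · exact hasSum_integral_of_dominated_convergence (fun k t => ‖F k t‖) hm
      (fun k => ae_of_all _ fun _ => le_rfl) hs i1
      (hs.mono fun t ht => ht.of_norm.hasSum)

/-- `w'` is the time derivative of the family `w` of functions on the torus, in a weak form: the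
modes of `w` are of class `C¹` with the modes of `w'` as derivatives, and the `L¹(𝕋)` norms of `w` and
`w'` are continuous in time. -/
structure HasTimeDeriv (w w' : ℝ → Torus → ℝ) : Prop where
  hasDerivAt_coeff : ∀ k t, HasDerivAt (fun s => fourierCoeff (toC (w s)) k)
    (fourierCoeff (toC (w' t)) k) t
  continuous_coeff : ∀ k, Continuous fun t => fourierCoeff (toC (w' t)) k
  continuous_norm : Continuous fun t => ∫ x, |w t x| ∂haar
  continuous_norm_deriv : Continuous fun t => ∫ x, |w' t x| ∂haar

lemma HasTimeDeriv.continuous_coeff_self {w w' : ℝ → Torus → ℝ} (hw : HasTimeDeriv w w') (k : ℤ) :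
    Continuous fun t => fourierCoeff (toC (w t)) k :=
  continuous_iff_continuousAt.2 fun t => (hw.hasDerivAt_coeff k t).continuousAt

section timeDependent

variable {f g w w' : ℝ → Torus → ℝ} {M N : ℝ≥0} {θ : ℝ → ℝ}

lemma aestronglyMeasurable_absPairing_term (hf : BddInSobolev 2 M f)
    (hw : ∀ k, Continuous fun t => fourierCoeff (toC (w t)) k) (k : ℤ) :
    AEStronglyMeasurable (fun t => |(k : ℝ)| *
      (fourierCoeff (toC (w t)) (-k) * fourierCoeff (toC (f t)) k).re) volume :=
  (Complex.continuous_re.comp_aestronglyMeasurable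
    ((hw _).aestronglyMeasurable.mul (hf.aestronglyMeasurable_coeff k))).const_mul _

lemma aestronglyMeasurable_absPairing (hf : BddInSobolev 2 M f)
    (hw : ∀ k, Continuous fun t => fourierCoeff (toC (w t)) k) :
    AEStronglyMeasurable (fun t => absPairing (f t) (w t)) volume :=
  aestronglyMeasurable_tsum (aestronglyMeasurable_absPairing_term hf hw)
    (hf.norm_le.mono fun _ ht => (summable_absPairing ht _).1.of_norm)

lemma integral_mul_absPairing (hf : BddInSobolev 2 M f)
    (hw : ∀ k, Continuous fun t => fourierCoeff (toC (w t)) k)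
    (hwn : Continuous fun t => ∫ x, |w t x| ∂haar) (hθ : Continuous θ)
    (hθc : HasCompactSupport θ) :
    Integrable (fun t => θ t * absPairing (f t) (w t)) ∧
    HasSum (fun k : ℤ => ∫ t, θ t * (|(k : ℝ)| *
        (fourierCoeff (toC (w t)) (-k) * fourierCoeff (toC (f t)) k).re))
      (∫ t, θ t * absPairing (f t) (w t)) := by
  have hB : Integrable fun t =>
      |θ t| * ((sobolevConst + (M : ℝ) ^ 2) * ∫ x, |w t x| ∂haar) := by
    refine Continuous.integrable_of_hasCompactSupport (by fun_prop) ?_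
    exact (hθc.comp_left (g := fun r : ℝ => |r|) abs_zero).mul_right
  have key := hasSum_integral_of_tsum_norm_le
    (F := fun (k : ℤ) t => θ t * (|(k : ℝ)| *
        (fourierCoeff (toC (w t)) (-k) * fourierCoeff (toC (f t)) k).re))
    (fun k => ?_) ?_ hB ?_
  · simpa only [tsum_mul_left, absPairing] using key
  · exact hθ.aestronglyMeasurable.mul (aestronglyMeasurable_absPairing_term hf hw k)
  · filter_upwards [hf.norm_le] with t ht
    simp_rw [norm_mul (θ t)]
    exact (summable_absPairing ht _).1.mul_left _
  · filter_upwards [hf.norm_le] with t ht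
    simp_rw [norm_mul (θ t)]
    rw [tsum_mul_left, Real.norm_eq_abs]
    exact mul_le_mul_of_nonneg_left (summable_absPairing ht _).2 (abs_nonneg _)

/-- The weak time derivative passes to the pairing with `|D|f`. -/
lemma integral_absPairing_deriv (hf : BddInSobolev 2 M f) (hg : BddInSobolev 2 N g)
    (hfg : IsWeakTimeDeriv f g) (hw : HasTimeDeriv w w') (hθ : ContDiff ℝ 1 θ)
    (hθc : HasCompactSupport θ) :
    (∫ t, deriv θ t * absPairing (f t) (w t)) + ∫ t, θ t * absPairing (f t) (w' t)
      = - ∫ t, θ t * absPairing (g t) (w t) := by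
  have hwc := hw.continuous_coeff_self
  have hθ' : Continuous (deriv θ) := hθ.continuous_deriv le_rfl
  have s1 := (integral_mul_absPairing hf hwc hw.continuous_norm hθ' hθc.deriv).2
  have s2 := (integral_mul_absPairing hf hw.continuous_coeff hw.continuous_norm_deriv
    hθ.continuous hθc).2
  have s3 := (integral_mul_absPairing hg hwc hw.continuous_norm hθ.continuous hθc).2
  refine (s1.add s2).unique (s3.neg.congr_fun fun k => ?_)
  have dθ : ∀ t, HasDerivAt θ (deriv θ t) t := fun t =>
    (hθ.differentiable (by norm_num) t).hasDerivAt
  have hder : ∀ t, HasDerivAt (fun t => (θ t : ℂ) * fourierCoeff (toC (w t)) (-k))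
      (((deriv θ t : ℝ) : ℂ) * fourierCoeff (toC (w t)) (-k)
        + (θ t : ℂ) * fourierCoeff (toC (w' t)) (-k)) t := fun t =>
    HasDerivAt.mul (dθ t).ofReal_comp (hw.hasDerivAt_coeff (-k) t)
  have hcpt : ∀ (η : ℝ → ℝ) (c : ℝ → ℂ), HasCompactSupport η →
      HasCompactSupport fun t => (η t : ℂ) * c t := fun η c hη =>
    (hη.comp_left (g := fun r : ℝ => (r : ℂ)) Complex.ofReal_zero).mul_right
  have hcont : ∀ (η : ℝ → ℝ) (c : ℝ → ℂ), Continuous η → Continuous c →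
      Continuous fun t => (η t : ℂ) * c t := fun η c hη hc =>
    (Complex.continuous_ofReal.comp hη).mul hc
  have hd : deriv (fun t => (θ t : ℂ) * fourierCoeff (toC (w t)) (-k)) = fun t =>
      ((deriv θ t : ℝ) : ℂ) * fourierCoeff (toC (w t)) (-k)
        + (θ t : ℂ) * fourierCoeff (toC (w' t)) (-k) := funext fun t => (hder t).deriv
  have hC1 : ContDiff ℝ 1 fun t => (θ t : ℂ) * fourierCoeff (toC (w t)) (-k) := by
    rw [contDiff_one_iff_deriv]
    refine ⟨fun t => (hder t).differentiableAt, ?_⟩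
    rw [hd]
    exact (hcont _ _ hθ' (hwc _)).add (hcont _ _ hθ.continuous (hw.continuous_coeff _))
  have key := hf.integral_deriv_mul_coeff hg hfg k hC1 (hcpt θ _ hθc)
  have int : ∀ (η : ℝ → ℝ) (c : ℝ → ℂ) {h : ℝ → Torus → ℝ} {L : ℝ≥0}, BddInSobolev 2 L h →
      Continuous η → HasCompactSupport η → Continuous c →
      Integrable fun t => (η t : ℂ) * c t * fourierCoeff (toC (h t)) k :=
    fun η c h L hh hη hηc hc => by
      simpa using (hh.locallyIntegrable_coeff k).integrable_smul_left_of_hasCompactSupport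
        (hcont η c hη hc) (hcpt η c hηc)
  have re_int : ∀ (η : ℝ → ℝ) (c : ℝ → ℂ) {h : ℝ → Torus → ℝ} {L : ℝ≥0}, BddInSobolev 2 L h →
      Continuous η → HasCompactSupport η → Continuous c →
      ∫ t, η t * (|(k : ℝ)| * (c t * fourierCoeff (toC (h t)) k).re)
        = |(k : ℝ)| * (∫ t, (η t : ℂ) * c t * fourierCoeff (toC (h t)) k).re :=
    fun η c h L hh hη hηc hc => by
      rw [← RCLike.re_eq_complex_re, ← integral_re (int η c hh hη hηc hc), ← integral_const_mul]
      congr 1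
      ext t
      rw [RCLike.re_eq_complex_re, mul_assoc, Complex.re_ofReal_mul]
      ring
  rw [re_int _ _ hf hθ' hθc.deriv (hwc _),
    re_int _ _ hf hθ.continuous hθc (hw.continuous_coeff _), re_int _ _ hg hθ.continuous hθc (hwc _),
    ← mul_add, ← Complex.add_re, ← integral_add (int _ _ hf hθ' hθc.deriv (hwc _))
      (int _ _ hf hθ.continuous hθc (hw.continuous_coeff _)), ← mul_neg, ← Complex.neg_re, ← key, hd]
  simp_rw [add_mul]

end timeDependent

/-! ### Functions of class `C¹` and `C²` of time and space -/

/-- The lift to `ℝ × ℝ` of a function on `ℝ × 𝕋`; `IsC2 f` is `ContDiff ℝ 2 (lift f)`. -/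
noncomputable def lift (f : ℝ → Torus → ℝ) : ℝ × ℝ → ℝ := fun p => f p.1 (p.2 : Torus)

lemma continuous_of_lift {f : ℝ → Torus → ℝ} (hf : Continuous (lift f)) :
    Continuous fun p : ℝ × Torus => f p.1 p.2 := by
  have hq : IsOpenQuotientMap (Prod.map (id : ℝ → ℝ) ((↑) : ℝ → Torus)) :=
    IsOpenQuotientMap.id.prodMap QuotientAddGroup.isOpenQuotientMap_mk
  exact hq.isQuotientMap.continuous_iff.2 hf

section C1

variable {f : ℝ → Torus → ℝ}

lemma lift_partialT (hf : ContDiff ℝ 1 (lift f)) :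
    lift (partialT f) = fun p => fderiv ℝ (lift f) p (1, 0) := by
  ext ⟨t, y⟩
  have h1 := ((hf.differentiable (by norm_num)) (t, y)).hasFDerivAt
  have h2 : HasDerivAt (fun τ : ℝ => ((τ, y) : ℝ × ℝ)) (1, 0) t :=
    (hasDerivAt_id t).prodMk (hasDerivAt_const t y)
  exact (h1.comp_hasDerivAt t h2).deriv

lemma hasDerivAt_space (hf : ContDiff ℝ 1 (lift f)) (t y : ℝ) :
    HasDerivAt (fun z : ℝ => f t (z : Torus)) (fderiv ℝ (lift f) (t, y) (0, 1)) y := by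
  have h1 := ((hf.differentiable (by norm_num)) (t, y)).hasFDerivAt
  have h2 : HasDerivAt (fun z : ℝ => ((t, z) : ℝ × ℝ)) (0, 1) y :=
    (hasDerivAt_const y t).prodMk (hasDerivAt_id y)
  exact h1.comp_hasDerivAt y h2

lemma lift_partialX (hf : ContDiff ℝ 1 (lift f)) :
    lift (partialX f) = fun p => fderiv ℝ (lift f) p (0, 1) := by
  ext ⟨t, y⟩
  have h1 : HasDerivAt (fun z : ℝ => f t (z : Torus)) (fderiv ℝ (lift f) (t, y) (0, 1)) (y + 0) := by
    rw [add_zero]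
    exact hasDerivAt_space hf t y
  have h2 := (h1.comp_const_add y 0).deriv
  simp only [AddCircle.coe_add] at h2
  exact h2

lemma contDiff_lift_partialT {n : WithTop ℕ∞} (hf : ContDiff ℝ (n + 1) (lift f)) :
    ContDiff ℝ n (lift (partialT f)) := by
  rw [lift_partialT (hf.of_le (by simp))]
  exact (hf.fderiv_right le_rfl).clm_apply contDiff_const

lemma contDiff_lift_partialX {n : WithTop ℕ∞} (hf : ContDiff ℝ (n + 1) (lift f)) :
    ContDiff ℝ n (lift (partialX f)) := by
  rw [lift_partialX (hf.of_le (by simp))]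
  exact (hf.fderiv_right le_rfl).clm_apply contDiff_const

lemma continuous_partialT (hf : ContDiff ℝ 1 (lift f)) :
    Continuous fun p : ℝ × Torus => partialT f p.1 p.2 :=
  continuous_of_lift (contDiff_lift_partialT (n := 0) (by simpa using hf)).continuous

lemma continuous_partialX (hf : ContDiff ℝ 1 (lift f)) :
    Continuous fun p : ℝ × Torus => partialX f p.1 p.2 :=
  continuous_of_lift (contDiff_lift_partialX (n := 0) (by simpa using hf)).continuous

lemma hasDerivAt_partialT (hf : ContDiff ℝ 1 (lift f)) (t : ℝ) (x : Torus) :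
    HasDerivAt (fun τ => f τ x) (partialT f t x) t := by
  induction x using QuotientAddGroup.induction_on with | _ y
  have h2 : HasDerivAt (fun τ : ℝ => ((τ, y) : ℝ × ℝ)) (1, 0) t :=
    (hasDerivAt_id t).prodMk (hasDerivAt_const t y)
  have h1 := ((hf.differentiable (by norm_num)) (t, y)).hasFDerivAt
  have h3 := h1.comp_hasDerivAt t h2
  have h4 : DifferentiableAt ℝ (fun τ => f τ (y : Torus)) t := h3.differentiableAt
  exact h4.hasDerivAt

lemma hasTorusDeriv_partialX (hf : ContDiff ℝ 1 (lift f)) (t : ℝ) :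
    HasTorusDeriv (f t) (partialX f t) where
  continuous := (continuous_of_lift hf.continuous).comp (Continuous.prodMk_right t)
  continuous_deriv := (continuous_partialX hf).comp (Continuous.prodMk_right t)
  hasDerivAt y := by
    have := congrFun (lift_partialX hf) (t, y)
    simp only [lift] at this
    rw [this]
    exact hasDerivAt_space hf t y

lemma continuous_integral {E : Type*} [NormedAddCommGroup E] [NormedSpace ℝ E]
    {F : ℝ → Torus → E} (hF : Continuous fun p : ℝ × Torus => F p.1 p.2) :
    Continuous fun t => ∫ x, F t x ∂haar := by
  have := continuous_parametric_integral_of_continuous (μ := haar) (f := F) hF isCompact_univ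
  simpa using this

/-- Differentiation under the integral sign on the torus. -/
lemma hasDerivAt_integral_mul (hf : ContDiff ℝ 1 (lift f)) {c : Torus → ℂ} (hc : Continuous c)
    (t : ℝ) : HasDerivAt (fun s => ∫ x, c x * (f s x : ℂ) ∂haar)
      (∫ x, c x * (partialT f t x : ℂ) ∂haar) t := by
  have hfc := continuous_of_lift hf.continuous
  have hdc := continuous_partialT hf
  have hcd : Continuous fun p : ℝ × Torus => c p.2 * (partialT f p.1 p.2 : ℂ) :=
    (hc.comp continuous_snd).mul (Complex.continuous_ofReal.comp hdc)
  have hcf : Continuous fun p : ℝ × Torus => c p.2 * (f p.1 p.2 : ℂ) :=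
    (hc.comp continuous_snd).mul (Complex.continuous_ofReal.comp hfc)
  obtain ⟨B, hB⟩ := ((isCompact_closedBall t 1).prod (isCompact_univ (X := Torus))).exists_bound_of_continuousOn
    hcd.continuousOn
  refine (hasDerivAt_integral_of_dominated_loc_of_deriv_le (bound := fun _ => B)
    (F := fun s x => c x * (f s x : ℂ)) (F' := fun s x => c x * (partialT f s x : ℂ))
    (Metric.closedBall_mem_nhds t one_pos) ?_ ?_ ?_ ?_ (integrable_const _) ?_).2
  · exact Filter.Eventually.of_forall fun s =>
      (hcf.comp (Continuous.prodMk_right s)).aestronglyMeasurable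
  · exact (hcf.comp (Continuous.prodMk_right t)).integrable_of_hasCompactSupport
      (HasCompactSupport.of_compactSpace _)
  · exact (hcd.comp (Continuous.prodMk_right t)).aestronglyMeasurable
  · exact ae_of_all _ fun x s hs => hB (s, x) ⟨hs, Set.mem_univ _⟩
  · exact ae_of_all _ fun x s _ => (hasDerivAt_partialT hf s x).ofReal_comp.const_mul _

lemma hasTimeDeriv_partialT (hf : ContDiff ℝ 1 (lift f)) : HasTimeDeriv f (partialT f) where
  hasDerivAt_coeff k t := hasDerivAt_integral_mul hf (map_continuous (fourier (-k))) t
  continuous_coeff k := by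
    refine continuous_integral ?_
    exact ((map_continuous (fourier (-k))).comp continuous_snd).smul
      (Complex.continuous_ofReal.comp (continuous_partialT hf))
  continuous_norm := continuous_integral (continuous_of_lift hf.continuous).abs
  continuous_norm_deriv := continuous_integral (continuous_partialT hf).abs

lemma hasDerivAt_integral (hf : ContDiff ℝ 1 (lift f)) (t : ℝ) :
    HasDerivAt (fun s => ∫ x, f s x ∂haar) (∫ x, partialT f t x ∂haar) t := by
  have h := hasDerivAt_integral_mul hf (c := fun _ => 1) continuous_const t
  simp only [one_mul, integral_complex_ofReal] at h
  have := Complex.reCLM.hasFDerivAt.comp_hasDerivAt t h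
  simpa [Function.comp_def] using this

lemma partialT_sq (hf : ContDiff ℝ 1 (lift f)) (t : ℝ) (x : Torus) :
    partialT (fun t x => f t x ^ 2) t x = 2 * (f t x * partialT f t x) := by
  refine ((hasDerivAt_partialT hf t x).pow 2).deriv.trans ?_
  simp
  ring

lemma contDiff_lift_sq {n : WithTop ℕ∞} (hf : ContDiff ℝ n (lift f)) :
    ContDiff ℝ n (lift fun t x => f t x ^ 2) := hf.pow 2

end C1

lemma partialX_partialT {f : ℝ → Torus → ℝ} (hf : ContDiff ℝ 2 (lift f)) (t : ℝ) (x : Torus) :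
    partialX (partialT f) t x = partialT (partialX f) t x := by
  have hf1 : ContDiff ℝ 1 (lift f) := hf.of_le (by norm_num)
  have hT : ContDiff ℝ 1 (lift (partialT f)) := contDiff_lift_partialT (by norm_num; exact hf)
  have hX : ContDiff ℝ 1 (lift (partialX f)) := contDiff_lift_partialX (by norm_num; exact hf)
  induction x using QuotientAddGroup.induction_on with | _ y
  have h1 := congrFun (lift_partialX hT) (t, y)
  have h2 := congrFun (lift_partialT hX) (t, y)
  simp only [lift] at h1 h2
  have hd : DifferentiableAt ℝ (fderiv ℝ (lift f)) (t, y) :=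
    (hf.fderiv_right (m := 1) (by norm_num)).differentiable (by norm_num) _
  have hsymm : IsSymmSndFDerivAt ℝ (lift f) (t, y) :=
    hf.contDiffAt.isSymmSndFDerivAt (by simp)
  refine h1.trans (Eq.trans ?_ h2.symm)
  rw [lift_partialT hf1, lift_partialX hf1, fderiv_clm_apply hd (differentiableAt_const _),
    fderiv_clm_apply hd (differentiableAt_const _)]
  simpa using hsymm.eq (0, 1) (1, 0)

/-- Integration by parts on the torus. -/
lemma HasTorusDeriv.integral_mul_deriv {f f' g g' : Torus → ℝ} (hf : HasTorusDeriv f f')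
    (hg : HasTorusDeriv g g') : ∫ x, f x * g' x ∂haar = - ∫ x, f' x * g x ∂haar := by
  have h : HasTorusDeriv (fun x => f x * g x) (fun x => f' x * g x + f x * g' x) :=
    ⟨hf.1.mul hg.1, (hf.2.mul hg.1).add (hf.1.mul hg.2), fun y => (hf.3 y).mul (hg.3 y)⟩
  -- the mean of a derivative vanishes
  have h0 := h.fourierCoeff_eq 0
  have i : ∀ {p : Torus → ℝ}, Continuous p → Integrable p haar := fun hp =>
    hp.integrable_of_hasCompactSupport (HasCompactSupport.of_compactSpace _)
  simp only [fourierCoeff, neg_zero, fourier_zero, one_smul, toC, Int.cast_zero, mul_zero,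
    zero_mul, integral_complex_ofReal, Complex.ofReal_eq_zero] at h0
  have i1 : Integrable (fun x => f' x * g x) haar := i (hf.2.mul hg.1)
  have i2 : Integrable (fun x => f x * g' x) haar := i (hf.1.mul hg.2)
  rw [integral_add i1 i2] at h0
  linarith

/-! ### The weighted energy estimate in time -/

open Filter Topology in
/-- The weighted energy estimate, in abstract form. Here `ℰ` is an energy equivalent to `X`, whose
weak derivative `2T` is controlled by `X` and by the source `N` (which need not be measurable). -/
lemma weighted_energy_estimate {γ m D C : ℝ} (hγ : 0 < γ) (hm : 0 < m) (hD : 4 * D ≤ γ * m)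
    {X ℰ T : ℝ → ℝ} {N : ℝ → ℝ≥0∞} (hX0 : ∀ t, 0 ≤ X t)
    (hX : Integrable fun t => Real.exp (-(2 * γ * t)) * X t)
    (hℰ : AEStronglyMeasurable ℰ volume) (hlow : ∀ᵐ t, m * X t ≤ ℰ t)
    (hup : ∀ᵐ t, |ℰ t| ≤ C * X t) (hT : AEStronglyMeasurable T volume)
    (hTN : ∀ᵐ t, ENNReal.ofReal (γ * m * (T t - (γ * m / 4 + D) * X t)) ≤ N t)
    (hid : ∀ θ : ℝ → ℝ, ContDiff ℝ 1 θ → HasCompactSupport θ →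
      Integrable (fun t => θ t * T t) ∧ ∫ t, θ t * T t = -(1 / 2) * ∫ t, deriv θ t * ℰ t) :
    ENNReal.ofReal γ * ∫⁻ t, ENNReal.ofReal (Real.exp (-(2 * γ * t)) * X t)
      ≤ ENNReal.ofReal (2 / m ^ 2 / γ) *
        ∫⁻ t, ENNReal.ofReal (Real.exp (-(2 * γ * t))) * N t := by
  set e : ℝ → ℝ := fun t => Real.exp (-(2 * γ * t)) with he
  have he0 : ∀ t, 0 < e t := fun t => Real.exp_pos _
  have hec : Continuous e := by rw [he]; fun_prop
  have hed : ∀ t, HasDerivAt e (-(2 * γ) * e t) t := fun t => by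
    have : HasDerivAt (fun t : ℝ => -(2 * γ * t)) (-(2 * γ)) t := by
      simpa using ((hasDerivAt_id t).const_mul (2 * γ)).fun_neg
    simpa [he, mul_comm] using this.exp
  rcases eq_or_ne (∫⁻ t, ENNReal.ofReal (e t) * N t) ⊤ with htop | hfin
  · rw [htop, ENNReal.mul_top]
    · exact le_top
    · simpa using by positivity
  -- the measurable function of `t` for which `N` serves as an upper bound
  set N' : ℝ → ℝ := fun t => max 0 (γ * m * (T t - (γ * m / 4 + D) * X t)) with hN'
  have hXm : AEStronglyMeasurable X volume := by
    have h : AEStronglyMeasurable (fun t => (e t)⁻¹ * (e t * X t)) volume :=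
      (hec.inv₀ fun t => (he0 t).ne').aestronglyMeasurable.mul hX.aestronglyMeasurable
    refine h.congr (ae_of_all _ fun t => ?_)
    exact inv_mul_cancel_left₀ (he0 t).ne' _
  have hN'm : AEStronglyMeasurable N' volume := by
    have : AEStronglyMeasurable (fun t => γ * m * (T t - (γ * m / 4 + D) * X t)) volume :=
      (hT.sub (hXm.const_mul _)).const_mul _
    exact aestronglyMeasurable_const.sup this
  have hN'0 : ∀ t, 0 ≤ N' t := fun t => le_max_left _ _
  have hle : ∫⁻ t, ENNReal.ofReal (e t * N' t) ≤ ∫⁻ t, ENNReal.ofReal (e t) * N t := by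
    refine lintegral_mono_ae ?_
    filter_upwards [hTN] with t ht
    rw [ENNReal.ofReal_mul (he0 t).le]
    gcongr
    rw [hN']
    simpa [ENNReal.ofReal_max] using ht
  have hN'i : Integrable fun t => e t * N' t := by
    refine ⟨hec.aestronglyMeasurable.mul hN'm, ?_⟩
    rw [hasFiniteIntegral_iff_ofReal (ae_of_all _ fun t => mul_nonneg (he0 t).le (hN'0 t))]
    exact lt_of_le_of_lt hle hfin.lt_top
  have hℰi : Integrable fun t => e t * ℰ t := by
    refine (hX.const_mul C).mono' (hec.aestronglyMeasurable.mul hℰ) ?_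
    filter_upwards [hup] with t ht
    rw [norm_mul, Real.norm_of_nonneg (he0 t).le, Real.norm_eq_abs, mul_left_comm]
    gcongr
  set B : ℝ → ℝ := fun t => (γ * m / 4 + D) * (e t * X t) + (γ * m)⁻¹ * (e t * N' t) with hB
  have hBi : Integrable B := (hX.const_mul _).add (hN'i.const_mul _)
  -- truncation in time
  let χ : ContDiffBump (0 : ℝ) := ⟨1, 2, one_pos, one_lt_two⟩
  have hχ1 : ContDiff ℝ 1 χ := χ.contDiff
  have hχd : Continuous (deriv χ) := hχ1.continuous_deriv le_rfl
  obtain ⟨L, hL⟩ := hχd.bounded_above_of_compact_support χ.hasCompactSupport.deriv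
  let s : ℕ → ℝ := fun n => 1 / ((n : ℝ) + 1)
  have hs0 : ∀ n, 0 < s n := fun n => by positivity
  have hs1 : ∀ n, s n ≤ 1 := fun n => by
    change 1 / ((n : ℝ) + 1) ≤ 1
    rw [div_le_one (by positivity)]
    linarith [Nat.cast_nonneg (α := ℝ) n]
  have hs : Tendsto s atTop (𝓝 0) := tendsto_one_div_add_atTop_nhds_zero_nat
  let θ : ℕ → ℝ → ℝ := fun n t => e t * χ (s n * t)
  have hθd : ∀ n t, HasDerivAt (θ n)
      (-(2 * γ) * e t * χ (s n * t) + e t * (deriv χ (s n * t) * s n)) t := fun n t => by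
    have h1 : HasDerivAt (fun t => s n * t) (s n) t := by
      simpa using (hasDerivAt_id t).const_mul (s n)
    have h2 : HasDerivAt χ (deriv χ (s n * t)) (s n * t) :=
      (hχ1.differentiable (by norm_num) _).hasDerivAt
    exact (hed t).mul (h2.comp t h1)
  have hθ1 : ∀ n, ContDiff ℝ 1 (θ n) := fun n => by
    have : ContDiff ℝ 1 e := by rw [he]; fun_prop
    exact this.mul (hχ1.comp (contDiff_const.mul contDiff_id))
  have hθc : ∀ n, HasCompactSupport (θ n) := fun n => by
    refine HasCompactSupport.mul_left ?_
    exact χ.hasCompactSupport.comp_homeomorph (Homeomorph.mulLeft₀ (s n) (hs0 n).ne')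
  have hlimχ : ∀ t, Tendsto (fun n => χ (s n * t)) atTop (𝓝 1) := fun t => by
    have h1 : Tendsto (fun n => s n * t) atTop (𝓝 0) := by simpa using hs.mul_const t
    have h2 := (χ.continuous.tendsto 0).comp h1
    have h3 : χ (0 : ℝ) = 1 := χ.one_of_mem_closedBall (by simp [χ])
    rwa [h3] at h2
  have lim1 : Tendsto (fun n => ∫ t, χ (s n * t) * B t) atTop (𝓝 (∫ t, B t)) := by
    refine tendsto_integral_of_dominated_convergence (fun t => ‖B t‖) (fun n => ?_) hBi.norm
      (fun n => ae_of_all _ fun t => ?_) (ae_of_all _ fun t => ?_)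
    · exact (χ.continuous.comp (continuous_const_mul _)).aestronglyMeasurable.mul
        hBi.aestronglyMeasurable
    · rw [norm_mul, Real.norm_of_nonneg χ.nonneg]
      exact mul_le_of_le_one_left (norm_nonneg _) χ.le_one
    · simpa using (hlimχ t).mul_const (B t)
  have lim2 : Tendsto (fun n => ∫ t, deriv (θ n) t * ℰ t) atTop
      (𝓝 (∫ t, -(2 * γ) * (e t * ℰ t))) := by
    refine tendsto_integral_of_dominated_convergence (fun t => (2 * γ + L) * ‖e t * ℰ t‖)
      (fun n => ?_) (hℰi.norm.const_mul _) (fun n => ae_of_all _ fun t => ?_)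
      (ae_of_all _ fun t => ?_)
    · exact ((hθ1 n).continuous_deriv le_rfl).aestronglyMeasurable.mul hℰ
    · rw [(hθd n t).deriv, show (-(2 * γ) * e t * χ (s n * t) + e t * (deriv χ (s n * t) * s n)) * ℰ t
        = (-(2 * γ) * χ (s n * t) + deriv χ (s n * t) * s n) * (e t * ℰ t) by ring, norm_mul]
      gcongr
      refine (norm_add_le _ _).trans (add_le_add ?_ ?_)
      · rw [norm_mul, norm_neg, Real.norm_of_nonneg (by positivity), Real.norm_of_nonneg χ.nonneg]
        exact mul_le_of_le_one_right (by positivity) χ.le_one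
      · rw [norm_mul, Real.norm_of_nonneg (hs0 n).le]
        exact (mul_le_of_le_one_right (norm_nonneg _) (hs1 n)).trans (hL _)
    · have h1 : Tendsto (fun n => deriv χ (s n * t) * s n) atTop (𝓝 0) := by
        refine squeeze_zero_norm (fun n => ?_) (by simpa using hs.const_mul L)
        rw [norm_mul, Real.norm_of_nonneg (hs0 n).le]
        exact mul_le_mul_of_nonneg_right (hL _) (hs0 n).le
      have h2 := (((hlimχ t).const_mul (-(2 * γ))).add h1).mul_const (e t * ℰ t)
      simp only [mul_one, add_zero] at h2
      refine h2.congr fun n => ?_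
      rw [(hθd n t).deriv]
      ring
  have hTB : ∀ t, e t * T t ≤ B t := fun t => by
    have h1 : γ * m * (T t - (γ * m / 4 + D) * X t) ≤ N' t := le_max_right _ _
    have h2 : T t - (γ * m / 4 + D) * X t ≤ (γ * m)⁻¹ * N' t := by
      rw [le_inv_mul_iff₀ (by positivity)]
      exact h1
    have h3 := mul_le_mul_of_nonneg_left h2 (he0 t).le
    simp only [hB]
    nlinarith
  -- the identity tested with `θ n`; then `n → ∞`
  have step : ∀ n, -(1 / 2) * ∫ t, deriv (θ n) t * ℰ t ≤ ∫ t, χ (s n * t) * B t := fun n => by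
    obtain ⟨i1, i2⟩ := hid (θ n) (hθ1 n) (hθc n)
    rw [← i2]
    refine integral_mono i1 ?_ fun t => ?_
    · refine hBi.norm.mono' ?_ (ae_of_all _ fun t => ?_)
      · exact (χ.continuous.comp (continuous_const_mul _)).aestronglyMeasurable.mul
          hBi.aestronglyMeasurable
      · rw [norm_mul, Real.norm_of_nonneg χ.nonneg]
        exact mul_le_of_le_one_left (norm_nonneg _) χ.le_one
    · have := mul_le_mul_of_nonneg_left (hTB t) (χ.nonneg (x := s n * t))
      simp only [θ]
      linarith
  have final := le_of_tendsto_of_tendsto' (lim2.const_mul (-(1 / 2))) lim1 step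
  have hlow' : m * ∫ t, e t * X t ≤ ∫ t, e t * ℰ t := by
    rw [← integral_const_mul]
    refine integral_mono_ae (hX.const_mul m) hℰi ?_
    filter_upwards [hlow] with t ht
    have := mul_le_mul_of_nonneg_left ht (he0 t).le
    linarith
  rw [integral_const_mul, hB, integral_add (hX.const_mul _) (hN'i.const_mul _), integral_const_mul,
    integral_const_mul] at final
  set I := ∫ t, e t * X t
  set J := ∫ t, e t * N' t with hJ
  have hI0 : 0 ≤ I := integral_nonneg fun t => mul_nonneg (he0 t).le (hX0 t)
  have main : γ * I ≤ 2 / m ^ 2 / γ * J := by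
    have h1 : γ * (m * I) ≤ γ * ∫ t, e t * ℰ t := mul_le_mul_of_nonneg_left hlow' hγ.le
    have h2 : D * I ≤ γ * m / 4 * I := mul_le_mul_of_nonneg_right (by linarith) hI0
    -- a quarter of `γ m I` absorbs the term in `D`, another one is already in `B`
    have h3 : γ * m / 2 * I ≤ (γ * m)⁻¹ * J := by nlinarith
    calc γ * I = 2 / m * (γ * m / 2 * I) := by field_simp
      _ ≤ 2 / m * ((γ * m)⁻¹ * J) := by gcongr
      _ = _ := by field_simp
  calc ENNReal.ofReal γ * ∫⁻ t, ENNReal.ofReal (e t * X t)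
      = ENNReal.ofReal (γ * I) := by
        rw [ENNReal.ofReal_mul hγ.le, ofReal_integral_eq_lintegral_ofReal hX
          (ae_of_all _ fun t => mul_nonneg (he0 t).le (hX0 t))]
    _ ≤ ENNReal.ofReal (2 / m ^ 2 / γ * J) := ENNReal.ofReal_le_ofReal main
    _ = ENNReal.ofReal (2 / m ^ 2 / γ) * ∫⁻ t, ENNReal.ofReal (e t * N' t) := by
        rw [ENNReal.ofReal_mul (by positivity), ofReal_integral_eq_lintegral_ofReal hN'i
          (ae_of_all _ fun t => mul_nonneg (he0 t).le (hN'0 t))]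
    _ ≤ _ := by gcongr

/-! ### The energy of the linearized equation -/

/-- The energy `∫ φₜ² + (μ - 2 p₀ₓ) φₓ² dx / 2π`. -/
noncomputable def energy (μ : ℝ) (f φ : ℝ → Torus → ℝ) (t : ℝ) : ℝ :=
  ∫ x, partialT φ t x ^ 2 ∂haar + μ * ∫ x, partialX φ t x ^ 2 ∂haar
    - 2 * absPairing (f t) (fun x => partialX φ t x ^ 2)

/-- Half of the time derivative of the energy, when `g` is the time derivative of `f`. -/
noncomputable def energyRate (μ : ℝ) (f g φ : ℝ → Torus → ℝ) (t : ℝ) : ℝ :=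
  ∫ x, partialT φ t x * partialT (partialT φ) t x ∂haar
    + μ * ∫ x, partialX φ t x * partialT (partialX φ) t x ∂haar
    - absPairing (f t) (partialT (fun t x => partialX φ t x ^ 2) t)
    - absPairing (g t) (fun x => partialX φ t x ^ 2)

section

variable {μ : ℝ} {M N : ℝ≥0} {f g φ : ℝ → Torus → ℝ}

lemma contDiff_lift_partialT_of_two (hφ : ContDiff ℝ 2 (lift φ)) :
    ContDiff ℝ 1 (lift (partialT φ)) :=
  contDiff_lift_partialT (by norm_num; exact hφ)

lemma contDiff_lift_partialX_of_two (hφ : ContDiff ℝ 2 (lift φ)) :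
    ContDiff ℝ 1 (lift (partialX φ)) :=
  contDiff_lift_partialX (by norm_num; exact hφ)

lemma hasDerivAt_integral_sq {h : ℝ → Torus → ℝ} (hh : ContDiff ℝ 1 (lift h)) (t : ℝ) :
    HasDerivAt (fun t => ∫ x, h t x ^ 2 ∂haar) (2 * ∫ x, h t x * partialT h t x ∂haar) t := by
  have := hasDerivAt_integral (contDiff_lift_sq hh) t
  simp_rw [partialT_sq hh, integral_const_mul] at this
  exact this

lemma continuous_integral_mul_partialT {h : ℝ → Torus → ℝ} (hh : ContDiff ℝ 1 (lift h)) :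
    Continuous fun t => ∫ x, h t x * partialT h t x ∂haar :=
  continuous_integral ((continuous_of_lift hh.continuous).mul (continuous_partialT hh))

lemma continuous_integral_sq {h : ℝ → Torus → ℝ} (hh : ContDiff ℝ 1 (lift h)) :
    Continuous fun t => ∫ x, h t x ^ 2 ∂haar :=
  continuous_integral ((continuous_of_lift hh.continuous).pow 2)

lemma aestronglyMeasurable_energy (hf : BddInSobolev 2 M f) (hφ : ContDiff ℝ 2 (lift φ)) :
    AEStronglyMeasurable (energy μ f φ) volume := by
  have hX := contDiff_lift_partialX_of_two hφ
  exact ((continuous_integral_sq (contDiff_lift_partialT_of_two hφ)).add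
    ((continuous_integral_sq hX).const_mul μ)).aestronglyMeasurable.sub
    ((aestronglyMeasurable_absPairing hf
      (hasTimeDeriv_partialT (contDiff_lift_sq hX)).continuous_coeff_self).const_mul 2)

lemma aestronglyMeasurable_energyRate (hf : BddInSobolev 2 M f) (hg : BddInSobolev 2 N g)
    (hφ : ContDiff ℝ 2 (lift φ)) : AEStronglyMeasurable (energyRate μ f g φ) volume := by
  have hX := contDiff_lift_partialX_of_two hφ
  have hw := hasTimeDeriv_partialT (contDiff_lift_sq hX)
  exact ((((continuous_integral_mul_partialT (contDiff_lift_partialT_of_two hφ)).add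
    ((continuous_integral_mul_partialT hX).const_mul μ)).aestronglyMeasurable.sub
    (aestronglyMeasurable_absPairing hf hw.continuous_coeff))).sub
    (aestronglyMeasurable_absPairing hg hw.continuous_coeff_self)

/-- The energy identity, in the sense of distributions in time. -/
lemma integral_mul_energyRate (hf : BddInSobolev 2 M f) (hg : BddInSobolev 2 N g)
    (hfg : IsWeakTimeDeriv f g) (hφ : ContDiff ℝ 2 (lift φ)) {θ : ℝ → ℝ} (hθ : ContDiff ℝ 1 θ)
    (hθc : HasCompactSupport θ) :
    Integrable (fun t => θ t * energyRate μ f g φ t) ∧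
    ∫ t, θ t * energyRate μ f g φ t = -(1 / 2) * ∫ t, deriv θ t * energy μ f φ t := by
  have hT := contDiff_lift_partialT_of_two hφ
  have hX := contDiff_lift_partialX_of_two hφ
  have hw := hasTimeDeriv_partialT (contDiff_lift_sq hX)
  have hθ' : Continuous (deriv θ) := hθ.continuous_deriv le_rfl
  set A : ℝ → ℝ := fun t => ∫ x, partialT φ t x * partialT (partialT φ) t x ∂haar
    + μ * ∫ x, partialX φ t x * partialT (partialX φ) t x ∂haar with hA
  set E : ℝ → ℝ := fun t => ∫ x, partialT φ t x ^ 2 ∂haar + μ * ∫ x, partialX φ t x ^ 2 ∂haar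
    with hE
  have hAc : Continuous A := (continuous_integral_mul_partialT hT).add
    ((continuous_integral_mul_partialT hX).const_mul μ)
  have hEd : ∀ t, HasDerivAt E (2 * A t) t := fun t => by
    have := (hasDerivAt_integral_sq hT t).fun_add ((hasDerivAt_integral_sq hX t).const_mul μ)
    exact this.congr_deriv (by simp only [A]; ring)
  have hEc : Continuous E := continuous_iff_continuousAt.2 fun t => (hEd t).continuousAt
  have dθ : ∀ t, HasDerivAt θ (deriv θ t) t := fun t =>
    (hθ.differentiable (by norm_num) t).hasDerivAt
  have i1 : Integrable fun t => θ t * A t :=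
    (hθ.continuous.mul hAc).integrable_of_hasCompactSupport hθc.mul_right
  have i1' : Integrable fun t => deriv θ t * E t :=
    (hθ'.mul hEc).integrable_of_hasCompactSupport hθc.deriv.mul_right
  obtain ⟨i2, -⟩ := integral_mul_absPairing hf hw.continuous_coeff hw.continuous_norm_deriv
    hθ.continuous hθc
  obtain ⟨i3, -⟩ := integral_mul_absPairing hg hw.continuous_coeff_self hw.continuous_norm
    hθ.continuous hθc
  obtain ⟨i4, -⟩ := integral_mul_absPairing hf hw.continuous_coeff_self hw.continuous_norm
    hθ' hθc.deriv
  have key := integral_absPairing_deriv hf hg hfg hw hθ hθc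
  have ibp : ∫ t, θ t * A t = -(1 / 2) * ∫ t, deriv θ t * E t := by
    have h := integral_mul_deriv_eq_deriv_mul_of_integrable (u := θ) (v := E)
      (u' := deriv θ) (v' := fun t => 2 * A t) (fun t _ => dθ t) (fun t _ => hEd t)
      (by
        refine (i1.const_mul 2).congr (ae_of_all _ fun t => ?_)
        simp only [Pi.mul_apply]
        ring) i1'
      ((hθ.continuous.mul hEc).integrable_of_hasCompactSupport hθc.mul_right)
    have h2 : ∫ t, θ t * (2 * A t) = 2 * ∫ t, θ t * A t := by
      rw [← integral_const_mul]
      congr 1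
      ext t
      ring
    rw [h2] at h
    linarith
  have eT : ∀ t, θ t * energyRate μ f g φ t = θ t * A t
      - θ t * absPairing (f t) (partialT (fun t x => partialX φ t x ^ 2) t)
      - θ t * absPairing (g t) (fun x => partialX φ t x ^ 2) := fun t => by
    rw [energyRate]
    ring
  have eE : ∀ t, deriv θ t * energy μ f φ t = deriv θ t * E t
      - 2 * (deriv θ t * absPairing (f t) (fun x => partialX φ t x ^ 2)) := fun t => by
    rw [energy]
    ring
  have i12 : Integrable fun t => θ t * A t
      - θ t * absPairing (f t) (partialT (fun t x => partialX φ t x ^ 2) t) := i1.sub i2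
  simp_rw [eT, eE]
  refine ⟨i12.sub i3, ?_⟩
  rw [integral_sub i12 i3, integral_sub i1 i2, integral_sub i1' (i4.const_mul 2),
    integral_const_mul, ibp]
  linarith

/-- The energy controls the first derivatives where `μ - 2 p₀ₓ` is bounded below. -/
lemma le_energy {δ m t : ℝ} (hm1 : m ≤ 1) (hmδ : m ≤ δ / 2)
    (hh : MemLp (f t) 2 volume) (hM : sobolevNorm 2 (toC (f t)) ≤ M)
    (hφ : ContDiff ℝ 2 (lift φ))
    (hpos : ∀ᵐ x : Torus, δ / 2 ≤ μ - 2 * (Dx (hilbert (toC (f t))) x).re) :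
    m * (∫ x, partialT φ t x ^ 2 ∂haar + ∫ x, partialX φ t x ^ 2 ∂haar) ≤ energy μ f φ t := by
  have hxc : Continuous (partialX φ t) :=
    (hasTorusDeriv_partialX (contDiff_lift_partialX_of_two hφ) t).continuous
  have hpos' : ∀ᵐ x ∂haar, δ / 2 ≤ μ - 2 * dxHilbertRe (f t) x := by
    rw [AddCircle.volume_eq_smul_haarAddCircle, Measure.ae_ennreal_smul_measure_iff] at hpos
    · exact hpos
    · simpa using Real.two_pi_pos
  have i1 : Integrable (fun x => partialX φ t x ^ 2) haar :=
    (hxc.pow 2).integrable_of_hasCompactSupport (HasCompactSupport.of_compactSpace _)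
  have i2 : Integrable (fun x => dxHilbertRe (f t) x * partialX φ t x ^ 2) haar := by
    refine (integrable_mul_of_continuous (hxc.pow 2)
      (memLp_ofReal_re (hasCoeff_dx_hilbert hh hM).memLp)).congr (ae_of_all _ fun x => ?_)
    exact mul_comm _ _
  have h1 : m * ∫ x, partialX φ t x ^ 2 ∂haar
      ≤ μ * ∫ x, partialX φ t x ^ 2 ∂haar
        - 2 * ∫ x, dxHilbertRe (f t) x * partialX φ t x ^ 2 ∂haar := by
    rw [← integral_const_mul, ← integral_const_mul, ← integral_const_mul,
      ← integral_sub (i1.const_mul _) (i2.const_mul _)]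
    refine integral_mono_ae (i1.const_mul _) ((i1.const_mul _).sub (i2.const_mul _)) ?_
    filter_upwards [hpos'] with x hx
    have := mul_le_mul_of_nonneg_right (hmδ.trans hx) (sq_nonneg (partialX φ t x))
    linarith
  rw [energy, ← integral_dxHilbertRe_mul (w := fun x => partialX φ t x ^ 2) hh hM (hxc.pow 2)]
  have h2 : m * ∫ x, partialT φ t x ^ 2 ∂haar ≤ ∫ x, partialT φ t x ^ 2 ∂haar :=
    mul_le_of_le_one_left (integral_nonneg fun x => sq_nonneg _) hm1
  linarith

lemma abs_energy_le {t : ℝ} (hM : sobolevNorm 2 (toC (f t)) ≤ M) :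
    |energy μ f φ t| ≤ (1 + |μ| + 2 * (sobolevConst + (M : ℝ) ^ 2)) *
      (∫ x, partialT φ t x ^ 2 ∂haar + ∫ x, partialX φ t x ^ 2 ∂haar) := by
  have h1 := abs_absPairing_le hM (fun x => partialX φ t x ^ 2)
  simp only [abs_sq] at h1
  have hU : 0 ≤ ∫ x, partialT φ t x ^ 2 ∂haar := integral_nonneg fun x => sq_nonneg _
  have hV : 0 ≤ ∫ x, partialX φ t x ^ 2 ∂haar := integral_nonneg fun x => sq_nonneg _
  set U := ∫ x, partialT φ t x ^ 2 ∂haar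
  set V := ∫ x, partialX φ t x ^ 2 ∂haar
  have hK := sobolevConst_pos
  have hKM : 0 ≤ (sobolevConst + (M : ℝ) ^ 2) * U := by positivity
  have hμU : 0 ≤ |μ| * U := by positivity
  rw [energy]
  calc |U + μ * V - 2 * absPairing (f t) (fun x => partialX φ t x ^ 2)|
      ≤ |U| + |μ * V| + |2 * absPairing (f t) (fun x => partialX φ t x ^ 2)| :=
        (abs_sub _ _).trans (add_le_add_left (abs_add_le _ _) _)
    _ = U + |μ| * V + 2 * |absPairing (f t) (fun x => partialX φ t x ^ 2)| := by
        rw [abs_of_nonneg hU, abs_mul, abs_of_nonneg hV, abs_mul, abs_two]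
    _ ≤ _ := by nlinarith

/-- The energy inequality at a fixed time. -/
lemma energyRate_le {t ε : ℝ} (hε : 0 < ε) (hh : MemLp (f t) 2 volume)
    (hM : sobolevNorm 3 (toC (f t)) ≤ M) (hN : sobolevNorm 2 (toC (g t)) ≤ N)
    (hφ : ContDiff ℝ 2 (lift φ)) :
    ENNReal.ofReal (4 * ε * (energyRate μ f g φ t
        - (ε + (remainderConst M / 2 + (sobolevConst + (N : ℝ) ^ 2))) *
          (∫ x, partialT φ t x ^ 2 ∂haar + ∫ x, partialX φ t x ^ 2 ∂haar)))
      ≤ ∫⁻ x, ‖linearizedOp μ f φ t x‖ₑ ^ 2 ∂haar := by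
  have hT := contDiff_lift_partialT_of_two hφ
  have hX := contDiff_lift_partialX_of_two hφ
  have hM2 := (sobolevNorm_mono (by norm_num : 2 ≤ 3)).trans hM
  have hu := hasTorusDeriv_partialX (hφ.of_le (by norm_num)) t
  have hux := hasTorusDeriv_partialX hX t
  have hv := hasTorusDeriv_partialX hT t
  have httc : Continuous (partialT (partialT φ) t) :=
    (continuous_partialT hT).comp (Continuous.prodMk_right t)
  have hxtc : Continuous (partialT (partialX φ) t) :=
    (continuous_partialT hX).comp (Continuous.prodMk_right t)
  have hgc : Continuous fun x => partialT (partialT φ) t x - μ * partialX (partialX φ) t x :=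
    httc.sub (hux.continuous_deriv.const_mul μ)
  obtain ⟨hL, hpair⟩ := pairing_le hh hM hu hux hv hgc hε
  have eL : ∀ x, ((partialT (partialT φ) t x - μ * partialX (partialX φ) t x : ℝ) : ℂ)
      - Dx (linearizedFlux (toC (f t)) (toC (φ t))) x = linearizedOp μ f φ t x := fun x => by
    rw [linearizedOp]
    push_cast
    rfl
  simp_rw [eL] at hL hpair
  have i : ∀ {p : Torus → ℝ}, Continuous p → Integrable p haar := fun hp =>
    hp.integrable_of_hasCompactSupport (HasCompactSupport.of_compactSpace _)
  have e1 : ∫ x, partialT φ t x * (partialT (partialT φ) t x - μ * partialX (partialX φ) t x) ∂haar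
      = ∫ x, partialT φ t x * partialT (partialT φ) t x ∂haar
        + μ * ∫ x, partialX φ t x * partialT (partialX φ) t x ∂haar := by
    have h1 := hv.integral_mul_deriv hux
    simp_rw [partialX_partialT hφ] at h1
    have h2 : ∫ x, partialX φ t x * partialT (partialX φ) t x ∂haar
        = ∫ x, partialT (partialX φ) t x * partialX φ t x ∂haar := by
      congr 1
      ext x
      ring
    have i1 : Integrable (fun x => partialT φ t x * partialT (partialT φ) t x) haar :=
      i (hv.continuous.mul httc)
    have i2 : Integrable (fun x => μ * (partialT φ t x * partialX (partialX φ) t x)) haar :=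
      (i (hv.continuous.mul hux.continuous_deriv)).const_mul μ
    rw [h2, ← neg_eq_iff_eq_neg.2 h1, mul_neg, ← sub_eq_add_neg, ← integral_const_mul,
      ← integral_sub i1 i2]
    congr 1
    ext x
    ring
  have e2 : 2 * ∫ x, dxHilbertRe (f t) x * (partialX (partialT φ) t x * partialX φ t x) ∂haar
      = absPairing (f t) (partialT (fun t x => partialX φ t x ^ 2) t) := by
    have ew : partialT (fun t x => partialX φ t x ^ 2) t
        = fun x => 2 * (partialX φ t x * partialT (partialX φ) t x) :=
      funext fun x => partialT_sq hX t x
    have hwc : Continuous fun x => 2 * (partialX φ t x * partialT (partialX φ) t x) :=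
      continuous_const.mul (hux.continuous.mul hxtc)
    rw [ew, ← integral_dxHilbertRe_mul hh hM2 hwc, ← integral_const_mul]
    simp_rw [partialX_partialT hφ]
    congr 1
    ext x
    ring
  have e3 : ∫⁻ x, ‖linearizedOp μ f φ t x‖ₑ ^ 2 ∂haar
      = ENNReal.ofReal (∫ x, ‖linearizedOp μ f φ t x‖ ^ 2 ∂haar) := by
    rw [ofReal_integral_eq_lintegral_ofReal hL.norm.integrable_sq (ae_of_all _ fun x => sq_nonneg _)]
    congr 1
    ext x
    rw [ENNReal.ofReal_pow (norm_nonneg _), ofReal_norm]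
  have h3 := abs_absPairing_le hN (fun x => partialX φ t x ^ 2)
  simp only [abs_sq] at h3
  have h4 := (abs_le.1 h3).1
  have hU : 0 ≤ ∫ x, partialT φ t x ^ 2 ∂haar := integral_nonneg fun x => sq_nonneg _
  have hV : 0 ≤ ∫ x, partialX φ t x ^ 2 ∂haar := integral_nonneg fun x => sq_nonneg _
  rw [e3]
  refine ENNReal.ofReal_le_ofReal ?_
  rw [e1, e2] at hpair
  rw [energyRate]
  set U := ∫ x, partialT φ t x ^ 2 ∂haar
  set V := ∫ x, partialX φ t x ^ 2 ∂haar
  rw [← le_inv_mul_iff₀ (by positivity)]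
  have h5 : 0 ≤ ε * V := by positivity
  have h6 : 0 ≤ (sobolevConst + (N : ℝ) ^ 2) * U := by
    have := sobolevConst_pos
    positivity
  linarith

end

/-! ### Weighted norms -/

lemma weightedNormSq_eq {E : Type*} [NormedAddCommGroup E] [NormedSpace ℝ E] (γ : ℝ)
    (f : ℝ → Torus → E) : weightedNormSq γ f = ENNReal.ofReal (2 * Real.pi) *
      ∫⁻ t, ENNReal.ofReal (Real.exp (-(2 * γ * t))) * ∫⁻ x, ‖f t x‖ₑ ^ 2 ∂haar := by
  rw [weightedNormSq, ← lintegral_const_mul' _ _ ENNReal.ofReal_ne_top]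
  refine lintegral_congr fun t => ?_
  rw [AddCircle.volume_eq_smul_haarAddCircle, lintegral_smul_measure, smul_eq_mul,
    ← lintegral_const_mul' (ENNReal.ofReal (Real.exp _)) _ ENNReal.ofReal_ne_top]
  congr 1
  refine lintegral_congr fun x => ?_
  rw [enorm_smul, mul_pow, Real.enorm_of_nonneg (Real.exp_pos _).le,
    ← ENNReal.ofReal_pow (Real.exp_pos _).le, ← Real.exp_nat_mul]
  congr 3
  push_cast
  ring

lemma weightedNormSq_eq_of_continuous (γ : ℝ) {f : ℝ → Torus → ℝ}
    (hf : ∀ t, Continuous (f t)) : weightedNormSq γ f = ENNReal.ofReal (2 * Real.pi) *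
      ∫⁻ t, ENNReal.ofReal (Real.exp (-(2 * γ * t)) * ∫ x, f t x ^ 2 ∂haar) := by
  rw [weightedNormSq_eq]
  congr 2
  ext t
  have hi : Integrable (fun x => f t x ^ 2) haar :=
    ((hf t).pow 2).integrable_of_hasCompactSupport (HasCompactSupport.of_compactSpace _)
  rw [ENNReal.ofReal_mul (Real.exp_pos _).le,
    ofReal_integral_eq_lintegral_ofReal hi (ae_of_all _ fun x => sq_nonneg _)]
  congr 2
  ext x
  rw [← sq_abs, ENNReal.ofReal_pow (abs_nonneg _), ← Real.norm_eq_abs, ofReal_norm]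

end CurrentVortex

theorem theorem3p1 (δ : ℝ) (hδ : 0 < δ) :
    ∃ C₀ : ℝ, 0 < C₀ ∧
      ∀ M₀ M₁ : ℝ≥0, ∃ γ₀ : ℝ, 1 ≤ γ₀ ∧
        ∀ (μ : ℝ) (φ₀ φ₀t : ℝ → Torus → ℝ),
          MemLinftySobolev 3 φ₀ →
          IsWeakTimeDeriv φ₀ φ₀t →
          MemLinftySobolev 2 φ₀t →
          linftySobolevNorm 3 φ₀ ≤ M₀ →
          linftySobolevNorm 2 φ₀t ≤ M₁ →
          (∀ᵐ t : ℝ, ∫ x : Torus, φ₀ t x = 0) →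
          (∀ᵐ t : ℝ, ∀ᵐ x : Torus, δ / 2 ≤ μ - 2 * (Dx (hilbert (toC (φ₀ t))) x).re) →
          ∀ γ : ℝ, γ₀ ≤ γ →
            ∀ φ' : ℝ → Torus → ℝ,
              IsC2 φ' →
              (∀ t : ℝ, ∫ x : Torus, φ' t x = 0) →
              weightedNormSq γ (partialT φ') < ⊤ →
              weightedNormSq γ (partialX φ') < ⊤ →
              ENNReal.ofReal γ *
                  (weightedNormSq γ (partialT φ') + weightedNormSq γ (partialX φ'))
                ≤ ENNReal.ofReal (C₀ / γ) * weightedNormSq γ (linearizedOp μ φ₀ φ') := by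
  set m : ℝ := min 1 (δ / 2) with hm
  have hm0 : 0 < m := lt_min one_pos (by positivity)
  refine ⟨2 / m ^ 2, by positivity, fun M₀ M₁ => ?_⟩
  set D : ℝ := remainderConst M₀ / 2 + (sobolevConst + (M₁ : ℝ) ^ 2) with hD
  refine ⟨max 1 (4 * D / m), le_max_left _ _, ?_⟩
  intro μ f g hf hfg hg hM₀ hM₁ _ hpos γ hγ φ hφ _ hT hX
  have hγ0 : 0 < γ := lt_of_lt_of_le one_pos ((le_max_left _ _).trans hγ)
  have hDγ : 4 * D ≤ γ * m := (div_le_iff₀ hm0).1 ((le_max_right _ _).trans hγ)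
  have hf3 := hf.bddInSobolev hM₀
  have hf2 := hf3.mono (by norm_num : 2 ≤ 3)
  have hg2 := hg.bddInSobolev hM₁
  have hC2 : ContDiff ℝ 2 (lift φ) := hφ
  have cT := contDiff_lift_partialT_of_two hC2
  have cX := contDiff_lift_partialX_of_two hC2
  rw [weightedNormSq_eq_of_continuous γ fun t => (hasTorusDeriv_partialX cT t).continuous] at hT ⊢
  rw [weightedNormSq_eq_of_continuous γ fun t => (hasTorusDeriv_partialX cX t).continuous] at hX ⊢
  have h2π : ENNReal.ofReal (2 * Real.pi) ≠ 0 := by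
    simpa using Real.two_pi_pos
  have hint : ∀ {V : ℝ → ℝ}, Continuous V → (∀ t, 0 ≤ V t) →
      ENNReal.ofReal (2 * Real.pi) * ∫⁻ t, ENNReal.ofReal (Real.exp (-(2 * γ * t)) * V t) < ⊤ →
      Integrable fun t => Real.exp (-(2 * γ * t)) * V t := by
    intro V hV hV0 h
    refine ⟨(Continuous.mul (by fun_prop) hV).aestronglyMeasurable, ?_⟩
    rw [hasFiniteIntegral_iff_ofReal
      (ae_of_all _ fun t => mul_nonneg (Real.exp_pos _).le (hV0 t))]
    exact ENNReal.lt_top_of_mul_ne_top_right h.ne h2π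
  have iT := hint (continuous_integral_sq cT) (fun t => integral_nonneg fun x => sq_nonneg _) hT
  have iX := hint (continuous_integral_sq cX) (fun t => integral_nonneg fun x => sq_nonneg _) hX
  have key := weighted_energy_estimate (γ := γ) (m := m) (D := D)
    (X := fun t => ∫ x, partialT φ t x ^ 2 ∂haar + ∫ x, partialX φ t x ^ 2 ∂haar)
    (ℰ := energy μ f φ) (T := energyRate μ f g φ)
    (N := fun t => ∫⁻ x, ‖linearizedOp μ f φ t x‖ₑ ^ 2 ∂haar)
    hγ0 hm0 hDγ
    (fun t => add_nonneg (integral_nonneg fun x => sq_nonneg _)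
      (integral_nonneg fun x => sq_nonneg _))
    ((iT.add iX).congr (ae_of_all _ fun t => (mul_add _ _ _).symm))
    (aestronglyMeasurable_energy hf2 hC2)
    (by
      filter_upwards [hf2.memLp, hf2.norm_le, hpos] with t h1 h2 h3
      exact le_energy (min_le_left _ _) (min_le_right _ _) h1 h2 hC2 h3)
    (hf2.norm_le.mono fun t ht => abs_energy_le ht)
    (aestronglyMeasurable_energyRate hf2 hg2 hC2)
    (by
      filter_upwards [hf3.memLp, hf3.norm_le, hg2.norm_le] with t h1 h2 h3
      have := energyRate_le (μ := μ) (ε := γ * m / 4) (by positivity) h1 h2 h3 hC2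
      rwa [show 4 * (γ * m / 4) = γ * m by ring] at this)
    (fun θ hθ hθc => integral_mul_energyRate hf2 hg2 hfg hC2 hθ hθc)
  rw [weightedNormSq_eq, ← mul_add, mul_left_comm, mul_left_comm (ENNReal.ofReal (2 / m ^ 2 / γ))]
  refine mul_le_mul' le_rfl (le_trans (le_of_eq ?_) key)
  congr 1
  rw [← lintegral_add_left]
  · congr 1
    ext t
    rw [mul_add, ENNReal.ofReal_add]
    · exact mul_nonneg (Real.exp_pos _).le (integral_nonneg fun x => sq_nonneg _)
    · exact mul_nonneg (Real.exp_pos _).le (integral_nonneg fun x => sq_nonneg _)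
  · have := continuous_integral_sq cT
    fun_prop
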